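/- Let $X^\omega=\{0,1\}^{\omega}$ be the set of infinite binary words. Let $a,b$ be the transformations of $X^\omega$ defined recursively by $a(0w)=0\,b(w)$, $a(1w)=1w$, $b(0w)=1\,a(w)$, $b(1w)=0w$, and let $B=\langle a,b\rangle$ be the Basilica group. For $\xi\in X^\omega$ let $\Gamma_\xi$ be the orbital Schreier graph of $\xi$: the undirected multigraph (loops and multiple edges allowed) whose vertex set is the orbit $B\cdot\xi$ and which has, for each vertex $v$ and each $s\in\{a,b\}$, one edge joining $v$ and $s(v)$. A ray in a graph is an infinite sequence of distinct vertices, consecutive ones being adjacent; two rays are equivalent if for every finite set $S$ of vertices both have a tail in the same connected component of the complement of $S$; an end is an equivalence class of rays. Let $E_2$ be the set of all $\xi\in X^\omega$ such that $\Gamma_\xi$ has exactly two ends. Write $\xi\sim\eta$ (cofinal) if $\xi$ and $\eta$ differ in only finitely many letters. For $\xi=\alpha_1\beta_1\alpha_2\beta_2\ldots\in E_2$ with $\alpha_i,\beta_i\in\{0,1\}$, let $w$ be the longest prefix of $\xi$ that ends by a subword of the form $10^k1$ with $k\ge 0$ even; if $\alpha_i=0$ for all $i$, let instead $w$ be the empty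 word, and if $\beta_i=0$ for all $i$ let instead $w$ be the prefix of length $1$. **Theorem.** 1. For every $\xi\in E_2$ the prefix $w$ exists, and $\xi=w0x_10x_2\ldots$ for some $x_i\in\{0,1\}$. Put $\overline{\xi}=w0\overline{x}_10\overline{x}_2\ldots$, where $\overline{x}_i=1-x_i$. Then $\overline\xi\in E_2$. 2. For all $\xi,\eta\in E_2$, the graphs $\Gamma_\xi$ and $\Gamma_\eta$ are isomorphic as unrooted (and unlabelled) graphs if and only if $\xi\sim\eta$ or $\overline{\xi}\sim\eta$. 3. For every $\xi\in E_2$, the set of words $\eta\in X^\omega$ such that $\Gamma_\eta$ is isomorphic to $\Gamma_\xi$ as an unrooted (and unlabelled) graph consists of exactly two orbits of $B$. -/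

import Mathlib

namespace Basilica

/-! ### Infinite multigraphs: isomorphisms, rays and ends -/

/-- An isomorphism of (unrooted, unlabelled) undirected multigraphs: a bijection between the
vertices together with a bijection between the edges, compatible with the endpoints. -/
structure MultigraphIso {α β α' β' : Type*} (G : Graph α β) (H : Graph α' β') where
  vertexEquiv : G.vertexSet ≃ H.vertexSet
  edgeEquiv : G.edgeSet ≃ H.edgeSet
  isLink_iff : ∀ (e : G.edgeSet) (x y : G.vertexSet),
    G.IsLink e x y ↔ H.IsLink (edgeEquiv e) (vertexEquiv x) (vertexEquiv y)

/-- A ray: an infinite sequence of distinct vertices, consecutive ones being adjacent. -/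
structure Ray {V : Type*} (G : SimpleGraph V) where
  toFun : ℕ → V
  injective : Function.Injective toFun
  adj : ∀ n, G.Adj (toFun n) (toFun (n + 1))

/-- Two rays are equivalent if, for every finite set `S` of vertices, both have a tail in the same
component of `G \ S`. -/
def Ray.Equivalent {V : Type*} {G : SimpleGraph V} (r r' : Ray G) : Prop :=
  ∀ S : Finset V, ∃ C : G.ComponentCompl (S : Set V),
    ∃ N : ℕ, ∀ n ≥ N, r.toFun n ∈ C ∧ r'.toFun n ∈ C

/-- From some index on, a ray stays in one component of the complement of a finite set. -/
theorem Ray.exists_tail {V : Type*} {G : SimpleGraph V} (r : Ray G) (S : Finset V) :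
    ∃ C : G.ComponentCompl (S : Set V), ∃ N : ℕ, ∀ n ≥ N, r.toFun n ∈ C := by
  have hfin : (r.toFun ⁻¹' (S : Set V)).Finite :=
    S.finite_toSet.preimage r.injective.injOn
  obtain ⟨M, hM⟩ := hfin.bddAbove
  have hout : ∀ n ≥ M + 1, r.toFun n ∉ (S : Set V) := by
    intro n hn hmem
    have hle : n ≤ M := hM hmem
    omega
  refine ⟨G.componentComplMk (hout (M + 1) le_rfl), M + 1, fun n hn => ?_⟩
  induction n, hn using Nat.le_induction with
  | base => exact G.componentComplMk_mem _
  | succ n hn ih =>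
    obtain ⟨hv, hC⟩ := ih
    refine ⟨hout (n + 1) (by omega), ?_⟩
    rw [← hC]
    exact (G.componentComplMk_eq_of_adj hv (hout (n + 1) (by omega)) (r.adj n)).symm

theorem Ray.equivalence {V : Type*} (G : SimpleGraph V) :
    Equivalence (Ray.Equivalent : Ray G → Ray G → Prop) where
  refl r S := by
    obtain ⟨C, N, h⟩ := r.exists_tail S
    exact ⟨C, N, fun n hn => ⟨h n hn, h n hn⟩⟩
  symm h S := by
    obtain ⟨C, N, hN⟩ := h S
    exact ⟨C, N, fun n hn => (hN n hn).symm⟩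
  trans h₁ h₂ S := by
    obtain ⟨C, N, hN⟩ := h₁ S
    obtain ⟨D, M, hM⟩ := h₂ S
    obtain ⟨p, h1⟩ := (hN (max N M) (le_max_left _ _)).2
    obtain ⟨q, h2⟩ := (hM (max N M) (le_max_right _ _)).1
    have hCD : C = D := h1.symm.trans h2
    subst hCD
    exact ⟨C, max N M, fun n hn => ⟨(hN n (le_trans (le_max_left _ _) hn)).1,
      (hM n (le_trans (le_max_right _ _) hn)).2⟩⟩

/-- The ends of a graph: equivalence classes of rays. -/
def End {V : Type*} (G : SimpleGraph V) : Type _ :=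
  Quotient (⟨Ray.Equivalent, Ray.equivalence G⟩ : Setoid (Ray G))

/-- The number of ends of a multigraph. Rays and components only see the underlying
simple graph. -/
noncomputable def numEnds {α β : Type*} (G : Graph α β) : ℕ∞ :=
  ENat.card (End G.toSimpleGraph)

/-! ### Orbital Schreier graphs -/

/-- The orbital Schreier graph of `m` for the action of `G` on `M` and the generators `S`, as an
undirected multigraph: the vertices are the points of the orbit of `m`, and each `s ∈ S` and each
vertex `v` give one edge `(v, s)` joining `v` and `s • v` (a loop if `s • v = v`). -/
def schreierGraph {G M : Type*} [Group G] [MulAction G M] (S : Set G) (m : M) :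
    Graph M (M × G) where
  vertexSet := MulAction.orbit G m
  IsLink e x y := e.1 ∈ MulAction.orbit G m ∧ e.2 ∈ S ∧ s(e.1, e.2 • e.1) = s(x, y)
  isLink_symm _ _ := ⟨fun _ _ h => ⟨h.1, h.2.1, h.2.2.trans Sym2.eq_swap⟩⟩
  eq_or_eq_of_isLink_of_isLink := by
    rintro e x y v w ⟨-, -, h⟩ ⟨-, -, h'⟩
    have hmem : x ∈ s(v, w) := by
      rw [← h', h]
      exact Sym2.mem_mk_left x y
    exact Sym2.mem_iff.1 hmem
  left_mem_of_isLink := by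
    rintro e x y ⟨he, -, h⟩
    have hx : x ∈ s(e.1, e.2 • e.1) := by
      rw [h]
      exact Sym2.mem_mk_left x y
    rcases Sym2.mem_iff.1 hx with rfl | rfl
    · exact he
    · exact MulAction.mem_orbit_of_mem_orbit e.2 he

/-! ### The Basilica group -/

/-- Infinite binary words; `false` is the letter `0`, `true` is the letter `1`, and the first
letter has index `0`. -/
abbrev Word := ℕ → Bool

/-- The states of the automaton generating the Basilica group. -/
inductive State
  | a | b | id

/-- The transition map of the automaton. -/
def State.next : State → Bool → State
  | .a, false => .b
  | .a, true => .id
  | .b, false => .a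
  | .b, true => .id
  | .id, _ => .id

/-- The output map of the automaton. -/
def State.out : State → Bool → Bool
  | .a, x => x
  | .b, x => !x
  | .id, x => x

/-- The transformation of infinite words defined by the automaton started in a given state:
`s (x w) = out s x · (next s x) (w)`. -/
def State.run : State → Word → Word
  | s, ξ, 0 => s.out (ξ 0)
  | s, ξ, n + 1 => State.run (s.next (ξ 0)) (fun i => ξ (i + 1)) n

/-- The transformation inverse to `State.run s`. -/
def State.runInv : State → Word → Word
  | s, ξ, 0 => s.out (ξ 0)
  | s, ξ, n + 1 => State.runInv (s.next (s.out (ξ 0))) (fun i => ξ (i + 1)) n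

theorem State.out_out (s : State) (x : Bool) : s.out (s.out x) = x := by
  cases s <;> simp [State.out]

theorem State.runInv_run (s : State) (ξ : Word) : s.runInv (s.run ξ) = ξ := by
  funext n
  induction n generalizing s ξ with
  | zero => simp [State.run, State.runInv, State.out_out]
  | succ n ih =>
    have h := ih (s.next (ξ 0)) (fun i => ξ (i + 1))
    simpa [State.run, State.runInv, State.out_out] using h

theorem State.run_runInv (s : State) (ξ : Word) : s.run (s.runInv ξ) = ξ := by
  funext n
  induction n generalizing s ξ with
  | zero => simp [State.run, State.runInv, State.out_out]
  | succ n ih =>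
    have h := ih (s.next (s.out (ξ 0))) (fun i => ξ (i + 1))
    simpa [State.run, State.runInv] using h

/-- The permutation of infinite words defined by a state. -/
def State.perm (s : State) : Equiv.Perm Word where
  toFun := s.run
  invFun := s.runInv
  left_inv := s.runInv_run
  right_inv := s.run_runInv

/-- The Basilica group, generated by `a = (b, id)` and `b = ε (a, id)`. -/
def basilicaGroup : Subgroup (Equiv.Perm Word) :=
  Subgroup.closure {State.a.perm, State.b.perm}

/-- The generator `a` of the Basilica group. -/
def genA : basilicaGroup :=
  ⟨State.a.perm, Subgroup.subset_closure (Set.mem_insert _ _)⟩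

/-- The generator `b` of the Basilica group. -/
def genB : basilicaGroup :=
  ⟨State.b.perm, Subgroup.subset_closure (Set.mem_insert_of_mem _ rfl)⟩

/-- The infinite Schreier graph `Γ_ξ` of the Basilica group. -/
def Γ (ξ : Word) : Graph Word (Word × basilicaGroup) :=
  schreierGraph {genA, genB} ξ

/-- `E i` is the set of words `ξ` such that `Γ_ξ` has exactly `i` ends. -/
def E (i : ℕ) : Set Word := {ξ | numEnds (Γ ξ) = i}

/-! ### Cofinality and the word `ξ̄` -/

/-- Two infinite words are cofinal if they differ only in finitely many letters. -/
def Cofinal (ξ η : Word) : Prop := {n | ξ n ≠ η n}.Finite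

/-- The prefix of length `m` of `ξ` ends by a word of the form `1 0^k 1` with `k` even. -/
def EndsInEvenBlock (ξ : Word) (m : ℕ) : Prop :=
  ∃ j k : ℕ, Even k ∧ m = j + k + 2 ∧ ξ j = true ∧
    (∀ i, j < i → i < j + k + 1 → ξ i = false) ∧ ξ (j + k + 1) = true

/-- `m` is the length of the prefix `w` of `ξ = α₁β₁α₂β₂…`: if all the `αᵢ` vanish, `w` is empty;
if all the `βᵢ` vanish, `w` has length one; otherwise `w` is the longest prefix ending by
`1 0^k 1` with `k` even. -/
def IsRelevantPrefixLength (ξ : Word) (m : ℕ) : Prop :=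
  ((∀ i, ξ (2 * i) = false) ∧ m = 0) ∨
  ((∀ i, ξ (2 * i + 1) = false) ∧ (¬ ∀ i, ξ (2 * i) = false) ∧ m = 1) ∨
  ((¬ ∀ i, ξ (2 * i) = false) ∧ (¬ ∀ i, ξ (2 * i + 1) = false) ∧
    IsGreatest {m | EndsInEvenBlock ξ m} m)

open Classical in
/-- The length of the prefix `w` (see `IsRelevantPrefixLength`; the default value `0` if there is
no such prefix). -/
noncomputable def relevantLength (ξ : Word) : ℕ :=
  if h : ∃ m, IsRelevantPrefixLength ξ m then h.choose else 0

open Classical in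
/-- If `ξ = w 0 x₁ 0 x₂ …`, where `w` is the prefix of length `relevantLength ξ`, then
`bar ξ = w 0 (1 - x₁) 0 (1 - x₂) …`. -/
noncomputable def bar (ξ : Word) : Word := fun n =>
  if ∃ i, n = relevantLength ξ + 2 * i + 1 then !(ξ n) else ξ n

end Basilica

/-!
Write `a`, `b` for the generators. The proof rests on the following observations.

* Away from the orbit of `000…` the orbits are the cofinality classes (`Cofinal.mem_orbit`,
  `cofinal_of_mem_orbit`), since a transducer state becomes trivial after reading a letter `1`.

* If letters `1` occur infinitely often at even and at odd indices, then `Γ_ξ` has at most one end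
  (`subsingleton_end`). Indeed, if `ξ n = 1`, the words that agree with `ξ` from index `n` on form a
  finite set, and its complement is connected, because the word `w` obtained from `ξ` by removing
  the first `n` letters is not a cut vertex of `Γ_w`: `w` carries an `a`-loop and lies on a
  finite `b`-cycle (`joined_compl_singleton`). In the orbit of `000…` there are three rays in
  different cofinality classes, and an edge changes the cofinality class only at `000…`
  (`three_le_card_end`). So in a word with a two-ended graph the letters at the indices of one
  parity finally vanish, and it is not in the orbit of `000…`. This yields the prefix `w`.

* If the letters at odd indices of `ξ` vanish, the other letters are the digits of a 2-adic integer
  `x`, and `b` acts by `x ↦ x - 1`. The map `x ↦ -x` reverses this infinite `b`-orbit, and it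
  extends to an involution `reflect` of the set of all words which commutes with `a`, commutes with
  `b` off the infinite `b`-orbits and inverts `b` on them (`isSymmetry_reflect`). Hence `Γ_ξ` is
  isomorphic to `Γ_η` where `η` is the image of `ξ`. If `ξ` has a two-ended graph and its letters at
  odd indices finally vanish, then `η` agrees with `bar ξ` up to finitely many letters. For the
  other parity one adds a first letter (`IsSymmetry.lift`, `exists_symmetry`).

* Conversely, an isomorphism respects the labels, as the `a`-loops reveal the first letter of each
  vertex (`MultigraphIso.exists_isLabelIso`). As `Γ_{xξ}` arises from `Γ_ξ` by replacing `b`-edges by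
  `a`-edges and subdividing `a`-edges, an isomorphism descends to the words with the first letter
  removed (`IsLabelIso.descend`), so it preserves the number of leading zeros
  (`IsLabelIso.prefix_iff`). On an infinite `b`-orbit it is a translation or a reflection, and the
  positions of the words with many leading zeros determine the 2-adic integer
  (`IsLabelIso.mem_or_reflect_mem`): the image of `x` is `x` or `-x`.
-/

namespace Basilica

/-! ### Words and the two generators -/

/-- The word `x w`. -/
def cons (x : Bool) (w : Word) : Word
  | 0 => x
  | n + 1 => w n

/-- The word `w` with its first letter removed. -/
def tail (w : Word) : Word := fun n => w (n + 1)

/-- The word `000…`. -/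
def zeroWord : Word := fun _ => false

@[simp] theorem cons_zero (x : Bool) (w : Word) : cons x w 0 = x := rfl

@[simp] theorem cons_succ (x : Bool) (w : Word) (n : ℕ) : cons x w (n + 1) = w n := rfl

@[simp] theorem tail_cons (x : Bool) (w : Word) : tail (cons x w) = w := rfl

theorem cons_tail (w : Word) : cons (w 0) (tail w) = w := by
  funext n
  cases n <;> rfl

@[simp] theorem cons_inj {x y : Bool} {u v : Word} : cons x u = cons y v ↔ x = y ∧ u = v := by
  refine ⟨fun h => ⟨congrFun h 0, ?_⟩, fun ⟨h, h'⟩ => by rw [h, h']⟩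
  have := congrArg tail h
  simpa using this

theorem exists_cons (w : Word) : ∃ x u, w = cons x u := ⟨w 0, tail w, (cons_tail w).symm⟩

theorem exists_cons_cons (w : Word) : ∃ x y u, w = cons x (cons y u) :=
  ⟨w 0, w 1, tail (tail w), by funext n; rcases n with _ | _ | n <;> rfl⟩

/-- Coinduction for equality of words, two letters at a time. -/
theorem eq_of_bisim (P : Word → Word → Prop)
    (hP : ∀ u v, P u v → ∃ x y u' v', u = cons x (cons y u') ∧ v = cons x (cons y v') ∧
      (u' = v' ∨ P u' v')) {u v : Word} (h : P u v) : u = v := by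
  funext n
  induction n using Nat.twoStepInduction generalizing u v with
  | zero =>
    obtain ⟨x, y, u', v', rfl, rfl, -⟩ := hP _ _ h
    rfl
  | one =>
    obtain ⟨x, y, u', v', rfl, rfl, -⟩ := hP _ _ h
    rfl
  | more n ih _ =>
    obtain ⟨x, y, u', v', rfl, rfl, h' | h'⟩ := hP _ _ h
    · rw [h']
    · exact ih h'

theorem run_cons (s : State) (x : Bool) (w : Word) :
    s.run (cons x w) = cons (s.out x) ((s.next x).run w) := by
  funext n
  cases n <;> rfl

@[simp] theorem id_run (w : Word) : State.id.run w = w := by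
  funext n
  induction n generalizing w with
  | zero => rfl
  | succ n ih => exact ih _

@[simp] theorem a_run_false (w : Word) :
    State.a.run (cons false w) = cons false (State.b.run w) := run_cons _ _ _

@[simp] theorem a_run_true (w : Word) : State.a.run (cons true w) = cons true w := by
  simp [run_cons, State.out, State.next]

@[simp] theorem b_run_false (w : Word) :
    State.b.run (cons false w) = cons true (State.a.run w) := run_cons _ _ _

@[simp] theorem b_run_true (w : Word) : State.b.run (cons true w) = cons false w := by
  simp [run_cons, State.out, State.next]

theorem run_injective (s : State) : Function.Injective s.run := s.perm.injective

@[simp] theorem run_inj {s : State} {u v : Word} : s.run u = s.run v ↔ u = v :=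
  (run_injective s).eq_iff

theorem exists_run_eq (s : State) (w : Word) : ∃ u, s.run u = w := s.perm.surjective w

theorem b_run_ne (w : Word) : State.b.run w ≠ w := by
  obtain ⟨x, u, rfl⟩ := exists_cons w
  cases x <;> simp

theorem a_run_eq_iff (w : Word) : State.a.run w = w ↔ w 0 = true := by
  obtain ⟨x, u, rfl⟩ := exists_cons w
  cases x <;> simp [b_run_ne]

theorem b_run_zero (w : Word) : State.b.run w 0 = !(w 0) := rfl

theorem a_run_zero (w : Word) : State.a.run w 0 = w 0 := rfl

/-- A transducer state falls into the trivial state once it has read a letter `1`. -/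
theorem run_eq_of_gt (s : State) {w : Word} {n : ℕ} (h : w n = true) {m : ℕ} (hm : n < m) :
    s.run w m = w m := by
  induction n generalizing s w m with
  | zero =>
    obtain ⟨x, u, rfl⟩ := exists_cons w
    obtain ⟨m, rfl⟩ := Nat.exists_eq_succ_of_ne_zero (by omega : m ≠ 0)
    have hx : x = true := h
    subst hx
    have hs : s.next true = State.id := by cases s <;> rfl
    rw [run_cons, hs, id_run]
    rfl
  | succ n ih =>
    obtain ⟨x, u, rfl⟩ := exists_cons w
    obtain ⟨m, rfl⟩ := Nat.exists_eq_succ_of_ne_zero (by omega : m ≠ 0)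
    rw [run_cons]
    exact ih (s.next x) h (by omega)

/-- The transducer output depends only on the prefix read so far. -/
theorem run_congr_prefix (s : State) {u v : Word} {n : ℕ} (h : ∀ i < n, u i = v i) :
    ∀ i < n, s.run u i = s.run v i := by
  intro i hi
  induction i generalizing s u v n with
  | zero => exact congrArg s.out (h 0 hi)
  | succ i ih =>
    change (s.next (u 0)).run (tail u) i = (s.next (v 0)).run (tail v) i
    rw [h 0 (by omega)]
    exact ih _ (n := n - 1) (fun j hj => h (j + 1) (by omega)) (by omega)

theorem runInv_congr_prefix (s : State) {u v : Word} {n : ℕ} (h : ∀ i < n, u i = v i) :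
    ∀ i < n, s.runInv u i = s.runInv v i := by
  intro i hi
  induction i generalizing s u v n with
  | zero => exact congrArg s.out (h 0 hi)
  | succ i ih =>
    change (s.next (s.out (u 0))).runInv (tail u) i = (s.next (s.out (v 0))).runInv (tail v) i
    rw [h 0 (by omega)]
    exact ih _ (n := n - 1) (fun j hj => h (j + 1) (by omega)) (by omega)

/-! ### Cofinality and orbits -/

theorem cofinal_iff {u v : Word} : Cofinal u v ↔ ∃ N, ∀ n ≥ N, u n = v n := by
  constructor
  · intro h
    obtain ⟨M, hM⟩ := Set.Finite.bddAbove h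
    refine ⟨M + 1, fun n hn => ?_⟩
    by_contra hne
    have : n ≤ M := hM hne
    omega
  · rintro ⟨N, hN⟩
    refine (Set.finite_lt_nat N).subset fun n hn => ?_
    by_contra hlt
    exact hn (hN n (not_lt.1 hlt))

theorem Cofinal.symm {u v : Word} (h : Cofinal u v) : Cofinal v u := by
  rw [cofinal_iff] at *
  exact h.imp fun N hN n hn => (hN n hn).symm

theorem Cofinal.trans {u v w : Word} (h : Cofinal u v) (h' : Cofinal v w) : Cofinal u w := by
  rw [cofinal_iff] at *
  obtain ⟨N, hN⟩ := h
  obtain ⟨M, hM⟩ := h'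
  exact ⟨max N M, fun n hn => (hN n (le_of_max_le_left hn)).trans (hM n (le_of_max_le_right hn))⟩

theorem cofinal_run (s : State) {w : Word} (h : w ≠ zeroWord) : Cofinal (s.run w) w := by
  obtain ⟨n, hn⟩ := Function.ne_iff.1 h
  exact cofinal_iff.2 ⟨n + 1, fun m hm => run_eq_of_gt s (by simpa [zeroWord] using hn) hm⟩

/-- A set of words stable under `a`, `b` and their inverses. -/
def Invariant (C : Set Word) : Prop :=
  ∀ v, (State.a.run v ∈ C ↔ v ∈ C) ∧ (State.b.run v ∈ C ↔ v ∈ C)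

theorem Invariant.orbit_subset {C : Set Word} (hC : Invariant C) {ξ : Word} (hξ : ξ ∈ C) :
    MulAction.orbit basilicaGroup ξ ⊆ C := by
  rintro _ ⟨⟨g, hg⟩, rfl⟩
  change g ξ ∈ C
  suffices ∀ v, g v ∈ C ↔ v ∈ C from (this ξ).2 hξ
  induction hg using Subgroup.closure_induction with
  | mem g hg =>
    rcases hg with rfl | rfl
    · exact fun v => (hC v).1
    · exact fun v => (hC v).2
  | one => exact fun v => Iff.rfl
  | mul g h _ _ ihg ihh => exact fun v => (ihg (h v)).trans (ihh v)
  | inv g _ ih => exact fun v => by simpa using (ih (g⁻¹ v)).symm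

theorem orbit_invariant (ξ : Word) : Invariant (MulAction.orbit basilicaGroup ξ) := by
  intro v
  have key (g : basilicaGroup) :
      g • v ∈ MulAction.orbit basilicaGroup ξ ↔ v ∈ MulAction.orbit basilicaGroup ξ :=
    ⟨fun h => by simpa using MulAction.mem_orbit_of_mem_orbit g⁻¹ h,
      MulAction.mem_orbit_of_mem_orbit g⟩
  exact ⟨key genA, key genB⟩

theorem orbit_eq_of_mem {ξ η : Word} (h : η ∈ MulAction.orbit basilicaGroup ξ) :
    MulAction.orbit basilicaGroup η = MulAction.orbit basilicaGroup ξ :=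
  MulAction.orbit_eq_iff.2 h

/-- The orbit relation is preserved by adding a first letter: `1 w` and `0 w` are related by `b`,
while `a` and `b²` act on `0 w` as `b` and `a` act on `w`. -/
theorem cons_mem_orbit {u v : Word} (h : v ∈ MulAction.orbit basilicaGroup u) (x y : Bool) :
    cons y v ∈ MulAction.orbit basilicaGroup (cons x u) := by
  set C := MulAction.orbit basilicaGroup (cons x u) with hC
  have hinv : Invariant C := orbit_invariant _
  have h10 : ∀ w, cons false w ∈ C ↔ cons true w ∈ C := fun w => by
    simpa using (hinv (cons true w)).2
  have hcons : ∀ w y z, cons y w ∈ C → cons z w ∈ C := by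
    intro w y z hw
    cases y <;> cases z <;> simp_all
  have hD : Invariant {w | cons false w ∈ C} := by
    intro w
    constructor
    · have := (hinv (cons false w)).2
      rw [b_run_false, ← h10] at this
      exact this
    · simpa using (hinv (cons false w)).1
  have hu : u ∈ {w | cons false w ∈ C} := hcons u x false (MulAction.mem_orbit_self _)
  exact hcons v false y (hD.orbit_subset hu h)

theorem Cofinal.mem_orbit {u v : Word} (h : Cofinal u v) :
    v ∈ MulAction.orbit basilicaGroup u := by
  obtain ⟨N, hN⟩ := cofinal_iff.1 h
  clear h
  induction N generalizing u v with
  | zero =>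
    have : u = v := funext fun n => hN n n.zero_le
    exact this ▸ MulAction.mem_orbit_self u
  | succ N ih =>
    have := ih (u := tail u) (v := tail v) fun n hn => hN (n + 1) (by omega)
    have := cons_mem_orbit this (u 0) (v 0)
    rwa [cons_tail, cons_tail] at this

/-- Away from the orbit of `000…`, the orbits are contained in the cofinality classes. -/
theorem cofinal_of_mem_orbit {ξ η : Word} (hξ : zeroWord ∉ MulAction.orbit basilicaGroup ξ)
    (h : η ∈ MulAction.orbit basilicaGroup ξ) : Cofinal ξ η := by
  set O := MulAction.orbit basilicaGroup ξ with hO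
  have key : ∀ (s : State) v, v ∈ O → (Cofinal ξ (s.run v) ↔ Cofinal ξ v) := by
    intro s v hv
    have : v ≠ zeroWord := fun h => hξ (h ▸ hv)
    have := cofinal_run s this
    exact ⟨fun h => h.trans this, fun h => h.trans this.symm⟩
  have hinv : Invariant {v | v ∈ O ∧ Cofinal ξ v} := by
    intro v
    constructor
    · have h1 := (orbit_invariant ξ v).1
      refine ⟨fun ⟨h2, h3⟩ => ⟨h1.1 h2, (key _ v (h1.1 h2)).1 h3⟩,
        fun ⟨h2, h3⟩ => ⟨h1.2 h2, (key _ v h2).2 h3⟩⟩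
    · have h1 := (orbit_invariant ξ v).2
      refine ⟨fun ⟨h2, h3⟩ => ⟨h1.1 h2, (key _ v (h1.1 h2)).1 h3⟩,
        fun ⟨h2, h3⟩ => ⟨h1.2 h2, (key _ v h2).2 h3⟩⟩
  have : ξ ∈ {v | v ∈ O ∧ Cofinal ξ v} :=
    ⟨MulAction.mem_orbit_self ξ, cofinal_iff.2 ⟨0, fun _ _ => rfl⟩⟩
  exact (hinv.orbit_subset this h).2

/-! ### Infinite and finite orbits of the generator `b` -/

/-- All letters at odd indices vanish. Reading the other letters as the binary digits of a 2-adic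
integer, `b` acts on these words as `x ↦ x - 1`. -/
def OddZero (w : Word) : Prop := ∀ i, w (2 * i + 1) = false

@[simp] theorem oddZero_cons_cons {x y : Bool} {w : Word} :
    OddZero (cons x (cons y w)) ↔ y = false ∧ OddZero w := by
  constructor
  · intro h
    exact ⟨h 0, fun i => h (i + 1)⟩
  · rintro ⟨h, h'⟩ (_ | i)
    · exact h
    · exact h' i

theorem oddZero_zeroWord : OddZero zeroWord := fun _ => rfl

theorem OddZero.exists_cons_cons {w : Word} (h : OddZero w) :
    ∃ x u, OddZero u ∧ w = cons x (cons false u) := by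
  obtain ⟨x, y, u, rfl⟩ := Basilica.exists_cons_cons w
  rw [oddZero_cons_cons] at h
  exact ⟨x, u, h.2, by rw [h.1]⟩

/-- The generator `b` changes only letters at even indices. -/
theorem b_run_odd (w : Word) (i : ℕ) : State.b.run w (2 * i + 1) = w (2 * i + 1) := by
  induction i generalizing w with
  | zero =>
    obtain ⟨x, y, u, rfl⟩ := exists_cons_cons w
    cases x <;> cases y <;> simp
  | succ i ih =>
    obtain ⟨x, y, u, rfl⟩ := exists_cons_cons w
    have h : 2 * (i + 1) + 1 = 2 * i + 1 + 1 + 1 := by ring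
    rw [h]
    cases x <;> cases y <;> simp [ih]

@[simp] theorem oddZero_b_run {w : Word} : OddZero (State.b.run w) ↔ OddZero w := by
  simp [OddZero, b_run_odd]

theorem b_iterate_two_mul (n : ℕ) (x : Bool) (w : Word) :
    State.b.run^[2 * n] (cons x (cons false w)) = cons x (cons false (State.b.run^[n] w)) := by
  induction n generalizing w with
  | zero => rfl
  | succ n ih =>
    rw [Nat.mul_succ, Function.iterate_succ_apply, Function.iterate_succ_apply,
      Function.iterate_succ_apply]
    cases x <;> simp [ih]

theorem oddZero_b_iterate (n : ℕ) {w : Word} : OddZero (State.b.run^[n] w) ↔ OddZero w := by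
  induction n with
  | zero => rfl
  | succ n ih => rw [Function.iterate_succ_apply', oddZero_b_run, ih]

theorem b_iterate_zero (n : ℕ) (w : Word) : State.b.run^[n] w 0 = (decide (Odd n) ^^ w 0) := by
  induction n with
  | zero => simp
  | succ n ih =>
    rw [Function.iterate_succ_apply', b_run_zero, ih]
    by_cases h : Odd n <;> simp [h, Nat.odd_add_one]

theorem OddZero.b_iterate_ne {w : Word} (hw : OddZero w) {n : ℕ} (hn : n ≠ 0) :
    State.b.run^[n] w ≠ w := by
  induction n using Nat.strong_induction_on generalizing w with
  | _ n ih =>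
    intro h
    obtain ⟨m, rfl⟩ : Even n := by
      by_contra hodd
      have h0 := congrFun h 0
      rw [b_iterate_zero] at h0
      simp [Nat.not_even_iff_odd.1 hodd] at h0
    obtain ⟨x, u, hu, rfl⟩ := hw.exists_cons_cons
    rw [← two_mul, b_iterate_two_mul] at h
    simp only [cons_inj, true_and] at h
    exact ih m (by omega) hu (by omega) h

theorem OddZero.b_iterate_injective {w : Word} (hw : OddZero w) :
    Function.Injective fun n : ℕ => State.b.run^[n] w := by
  have key : ∀ m n : ℕ, m < n → State.b.run^[m] w ≠ State.b.run^[n] w := by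
    intro m n hmn h
    obtain ⟨k, rfl⟩ := Nat.exists_eq_add_of_lt hmn
    rw [add_assoc, Function.iterate_add_apply] at h
    exact hw.b_iterate_ne (Nat.succ_ne_zero k) ((run_injective _).iterate m h).symm
  intro m n h
  rcases lt_trichotomy m n with h' | h' | h'
  · exact absurd h (key m n h')
  · exact h'
  · exact absurd h.symm (key n m h')

/-- A letter `1` at an odd index makes the `b`-orbit finite. -/
theorem exists_b_iterate_eq {w : Word} (hw : ¬ OddZero w) : ∃ n > 0, State.b.run^[n] w = w := by
  obtain ⟨i, hi⟩ : ∃ i, w (2 * i + 1) = true := by simpa [OddZero] using hw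
  clear hw
  induction i generalizing w with
  | zero =>
    obtain ⟨x, y, u, rfl⟩ := exists_cons_cons w
    have hy : y = true := hi
    subst hy
    refine ⟨2, two_pos, ?_⟩
    cases x <;> simp
  | succ i ih =>
    obtain ⟨x, y, u, rfl⟩ := exists_cons_cons w
    cases y
    · obtain ⟨n, hn, h⟩ := ih (w := u) hi
      exact ⟨2 * n, by omega, by rw [b_iterate_two_mul, h]⟩
    · refine ⟨2, two_pos, ?_⟩
      cases x <;> simp

/-- The `b`-orbit of a word with vanishing odd letters meets every prefix `00…0`. -/
theorem OddZero.exists_b_iterate_prefix {w : Word} (hw : OddZero w) (k : ℕ) :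
    ∃ m, ∀ i < 2 * k, State.b.run^[m] w i = false := by
  induction k generalizing w with
  | zero => exact ⟨0, by simp⟩
  | succ k ih =>
    obtain ⟨x, u, hu, rfl⟩ := hw.exists_cons_cons
    obtain ⟨m, hm⟩ := ih hu
    have key : ∀ i < 2 * (k + 1), cons false (cons false (State.b.run^[m] u)) i = false := by
      rintro (_ | _ | i) hi
      · rfl
      · rfl
      · exact hm i (by omega)
    cases x
    · exact ⟨2 * m, by rwa [b_iterate_two_mul]⟩
    · refine ⟨2 * m + 1, ?_⟩
      rwa [Function.iterate_succ_apply', b_iterate_two_mul, b_run_true]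

/-! ### Symmetries of Schreier graphs -/

/-- An involution `φ` of the vertices and involutions `ρ g` of the edges labelled `g` which respect
the endpoints induce an isomorphism of orbital Schreier graphs. -/
theorem nonempty_schreierGraph_iso {G M : Type*} [Group G] [MulAction G M] {S : Set G} {φ : M → M}
    {ρ : G → M → M} (hφ : φ.Involutive) (hρ : ∀ g ∈ S, (ρ g).Involutive)
    (hlink : ∀ g ∈ S, ∀ v, s(ρ g v, g • ρ g v) = s(φ v, φ (g • v))) {m : M}
    (horb : ∀ v, φ v ∈ MulAction.orbit G (φ m) ↔ v ∈ MulAction.orbit G m) :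
    Nonempty (MultigraphIso (schreierGraph S m) (schreierGraph S (φ m))) := by
  have hedge : ∀ n (e : M × G), e ∈ (schreierGraph S n).edgeSet ↔
      e.1 ∈ MulAction.orbit G n ∧ e.2 ∈ S := fun n e =>
    ⟨fun ⟨_, _, h⟩ => ⟨h.1, h.2.1⟩, fun h => ⟨e.1, e.2 • e.1, h.1, h.2, rfl⟩⟩
  have hρorb : ∀ g ∈ S, ∀ v, ρ g v ∈ MulAction.orbit G (φ m) ↔ v ∈ MulAction.orbit G m := by
    intro g hg v
    have hgv : g • v ∈ MulAction.orbit G m ↔ v ∈ MulAction.orbit G m :=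
      ⟨fun h => by simpa using MulAction.mem_orbit_of_mem_orbit g⁻¹ h,
        MulAction.mem_orbit_of_mem_orbit g⟩
    have hmem : ρ g v ∈ s(φ v, φ (g • v)) := hlink g hg v ▸ Sym2.mem_mk_left _ _
    rcases Sym2.mem_iff.1 hmem with h | h <;> rw [h, horb]
    exact hgv
  have hmemE : ∀ e : M × G, (ρ e.2 e.1, e.2) ∈ (schreierGraph S (φ m)).edgeSet ↔
      e ∈ (schreierGraph S m).edgeSet := fun e => by
    rw [hedge, hedge]
    exact and_congr_left fun h => hρorb e.2 h e.1
  refine ⟨{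
    vertexEquiv :=
      { toFun := fun v => ⟨φ v, (horb v).2 v.2⟩
        invFun := fun v => ⟨φ v, (horb _).1 (by rw [hφ]; exact v.2)⟩
        left_inv := fun v => Subtype.ext (hφ v)
        right_inv := fun v => Subtype.ext (hφ v) }
    edgeEquiv :=
      { toFun := fun e => ⟨(ρ e.1.2 e.1.1, e.1.2), (hmemE e).2 e.2⟩
        invFun := fun e => ⟨(ρ e.1.2 e.1.1, e.1.2), (hmemE _).1 (by
          rw [hρ e.1.2 ((hedge _ _).1 e.2).2]; exact e.2)⟩
        left_inv := fun e => Subtype.ext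
          (Prod.ext (hρ e.1.2 ((hedge _ _).1 e.2).2 e.1.1) rfl)
        right_inv := fun e => Subtype.ext
          (Prod.ext (hρ e.1.2 ((hedge _ _).1 e.2).2 e.1.1) rfl) }
    isLink_iff := ?_ }⟩
  rintro ⟨⟨v, g⟩, he⟩ ⟨x, hx⟩ ⟨y, hy⟩
  obtain ⟨hv, hg⟩ := (hedge _ _).1 he
  have hinj : s(v, g • v) = s(x, y) ↔ s(ρ g v, g • ρ g v) = s(φ x, φ y) := by
    rw [hlink g hg v, ← Sym2.map_mk, ← Sym2.map_mk]
    exact (Sym2.map.injective hφ.injective).eq_iff.symm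
  exact ⟨fun h => ⟨(hρorb g hg v).2 h.1, hg, hinj.1 h.2.2⟩,
    fun h => ⟨hv, hg, hinj.2 h.2.2⟩⟩

/-- An involution of the set of words that maps the `a`-edges to `a`-edges and the `b`-edges to
`b`-edges, possibly reversing some of them; `ρ v` is the initial vertex of the image of the edge
with initial vertex `v`. -/
structure IsSymmetry (φ : Word → Word) : Prop where
  involutive : φ.Involutive
  exists_edge_map : ∀ s ∈ ({State.a, State.b} : Set State), ∃ ρ : Word → Word, ρ.Involutive ∧
    ∀ v, s(ρ v, s.run (ρ v)) = s(φ v, φ (s.run v))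

theorem genA_ne_genB : genA ≠ genB := by
  intro h
  have h1 : State.a.run zeroWord 0 = State.b.run zeroWord 0 :=
    congrFun (congrArg (fun g : basilicaGroup => g.1 zeroWord) h) 0
  simp [a_run_zero, b_run_zero, zeroWord] at h1

theorem IsSymmetry.map_mem_orbit {φ : Word → Word} (h : IsSymmetry φ) {ξ v : Word}
    (hv : v ∈ MulAction.orbit basilicaGroup ξ) : φ v ∈ MulAction.orbit basilicaGroup (φ ξ) := by
  have key : ∀ (C : Set Word), Invariant C → ∀ s ∈ ({State.a, State.b} : Set State), ∀ v,
      (φ (s.run v) ∈ C ↔ φ v ∈ C) := by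
    intro C hC s hs v
    obtain ⟨ρ, -, hρ⟩ := h.exists_edge_map s hs
    have hsC : s.run (ρ v) ∈ C ↔ ρ v ∈ C := by
      rcases hs with rfl | rfl
      exacts [(hC _).1, (hC _).2]
    rcases Sym2.eq_iff.1 (hρ v) with ⟨h1, h2⟩ | ⟨h1, h2⟩
    · rwa [h2, h1] at hsC
    · rw [h2, h1] at hsC
      exact hsC.symm
  have hinv : Invariant {v | φ v ∈ MulAction.orbit basilicaGroup (φ ξ)} := fun v =>
    ⟨key _ (orbit_invariant _) _ (by simp) v, key _ (orbit_invariant _) _ (by simp) v⟩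
  exact hinv.orbit_subset (MulAction.mem_orbit_self (φ ξ)) hv

theorem IsSymmetry.nonempty_iso {φ : Word → Word} (h : IsSymmetry φ) (ξ : Word) :
    Nonempty (MultigraphIso (Γ ξ) (Γ (φ ξ))) := by
  classical
  obtain ⟨ρa, ha, ha'⟩ := h.exists_edge_map State.a (by simp)
  obtain ⟨ρb, hb, hb'⟩ := h.exists_edge_map State.b (by simp)
  refine nonempty_schreierGraph_iso (ρ := fun g => if g = genA then ρa else ρb)
    h.involutive ?_ ?_ ?_
  · rintro g (rfl | rfl)
    · simpa using ha
    · simpa [genA_ne_genB.symm] using hb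
  · rintro g (rfl | rfl) v
    · simp only [if_true]
      exact ha' v
    · simp only [if_neg genA_ne_genB.symm]
      exact hb' v
  · refine fun v => ⟨fun hv => ?_, h.map_mem_orbit⟩
    have := h.map_mem_orbit hv
    rwa [h.involutive, h.involutive] at this

/-- The map `x w ↦ x φ(w)`. -/
def lift (φ : Word → Word) (w : Word) : Word := cons (w 0) (φ (tail w))

@[simp] theorem lift_cons (φ : Word → Word) (x : Bool) (w : Word) :
    lift φ (cons x w) = cons x (φ w) := rfl

/-- The graph `Γ_{xξ}` arises from `Γ_ξ` by turning each `b`-edge into an `a`-edge and subdividing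
each `a`-edge into two `b`-edges, so a symmetry commuting with `a` lifts. -/
theorem IsSymmetry.lift {φ : Word → Word} (h : IsSymmetry φ)
    (ha : ∀ v, φ (State.a.run v) = State.a.run (φ v)) : IsSymmetry (lift φ) := by
  have hinv : (Basilica.lift φ).Involutive := by
    intro v
    obtain ⟨x, u, rfl⟩ := exists_cons v
    simp [h.involutive u]
  refine ⟨hinv, ?_⟩
  rintro s (rfl | rfl)
  · obtain ⟨ρ, hρ, hρ'⟩ := h.exists_edge_map State.b (by simp)
    refine ⟨fun w => bif w 0 then Basilica.lift φ w else Basilica.lift ρ w, fun v => ?_,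
      fun v => ?_⟩
    · obtain ⟨x, u, rfl⟩ := exists_cons v
      cases x <;> simp [hρ u, h.involutive u]
    · obtain ⟨x, u, rfl⟩ := exists_cons v
      cases x
      · simpa using congrArg (Sym2.map (cons false)) (hρ' u)
      · simp
  · refine ⟨Basilica.lift φ, hinv, fun v => ?_⟩
    obtain ⟨x, u, rfl⟩ := exists_cons v
    cases x <;> simp [ha]

/-! ### The reflection -/

/-- The word obtained by changing all the letters at even indices. On the words with vanishing odd
letters, read as 2-adic integers, this is `x ↦ -1 - x`. -/
def flipEven (w : Word) : Word := fun n => if Even n then !(w n) else w n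

@[simp] theorem flipEven_cons_cons (x y : Bool) (w : Word) :
    flipEven (cons x (cons y w)) = cons (!x) (cons y (flipEven w)) := by
  funext n
  rcases n with _ | _ | n
  · rfl
  · rfl
  · simp [flipEven, Nat.even_add_one]

theorem flipEven_flipEven (w : Word) : flipEven (flipEven w) = w := by
  funext n
  by_cases h : Even n <;> simp [flipEven, h]

theorem oddZero_flipEven {w : Word} : OddZero (flipEven w) ↔ OddZero w := by
  simp [OddZero, flipEven]

open Classical in
/-- The involution of the set of words that keeps the prefix up to the first letter `1` at an even
index after which all the letters at odd indices vanish, and changes the later letters at even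
indices. On the words with vanishing odd letters, read as 2-adic integers, this is `x ↦ -x`. -/
noncomputable def reflect : Word → Word
  | w, 0 => w 0
  | w, 1 => w 1
  | w, n + 2 =>
    if w 0 = true ∧ w 1 = false ∧ OddZero (fun i => w (i + 2)) then
      flipEven (fun i => w (i + 2)) n
    else reflect (fun i => w (i + 2)) n

theorem reflect_of_oddZero {w : Word} (h : OddZero w) :
    reflect (cons true (cons false w)) = cons true (cons false (flipEven w)) := by
  funext n
  rcases n with _ | _ | n
  · rfl
  · rfl
  · exact if_pos ⟨rfl, rfl, h⟩

theorem reflect_of_not {x y : Bool} {w : Word} (h : ¬ (x = true ∧ y = false ∧ OddZero w)) :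
    reflect (cons x (cons y w)) = cons x (cons y (reflect w)) := by
  funext n
  rcases n with _ | _ | n
  · rfl
  · rfl
  · exact if_neg h

@[simp] theorem reflect_false (y : Bool) (w : Word) :
    reflect (cons false (cons y w)) = cons false (cons y (reflect w)) :=
  reflect_of_not (by simp)

@[simp] theorem reflect_one (x : Bool) (w : Word) :
    reflect (cons x (cons true w)) = cons x (cons true (reflect w)) :=
  reflect_of_not (by simp)

theorem reflect_of_not_oddZero (x y : Bool) {w : Word} (h : ¬ OddZero w) :
    reflect (cons x (cons y w)) = cons x (cons y (reflect w)) :=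
  reflect_of_not (by simp [h])

theorem reflect_odd (w : Word) (i : ℕ) : reflect w (2 * i + 1) = w (2 * i + 1) := by
  induction i generalizing w with
  | zero => rfl
  | succ i ih =>
    obtain ⟨x, y, u, rfl⟩ := exists_cons_cons w
    have h : 2 * (i + 1) + 1 = 2 * i + 1 + 1 + 1 := by ring
    rw [h]
    by_cases hc : x = true ∧ y = false ∧ OddZero u
    · obtain ⟨rfl, rfl, hu⟩ := hc
      simp [reflect_of_oddZero hu, flipEven]
    · simp [reflect_of_not hc, ih]

@[simp] theorem oddZero_reflect {w : Word} : OddZero (reflect w) ↔ OddZero w := by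
  simp [OddZero, reflect_odd]

theorem reflect_involutive : reflect.Involutive := by
  intro w
  refine eq_of_bisim (fun u v => u = reflect (reflect v)) ?_ rfl
  rintro _ w rfl
  obtain ⟨x, y, u, rfl⟩ := exists_cons_cons w
  by_cases hc : x = true ∧ y = false ∧ OddZero u
  · obtain ⟨rfl, rfl, hu⟩ := hc
    refine ⟨true, false, u, u, ?_, rfl, Or.inl rfl⟩
    rw [reflect_of_oddZero hu, reflect_of_oddZero (oddZero_flipEven.2 hu), flipEven_flipEven]
  · refine ⟨x, y, reflect (reflect u), u, ?_, rfl, Or.inr rfl⟩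
    rw [reflect_of_not hc, reflect_of_not (by rwa [oddZero_reflect])]

theorem reflect_a_run (w : Word) : reflect (State.a.run w) = State.a.run (reflect w) := by
  refine eq_of_bisim (fun u v => ∃ w, u = reflect (State.a.run w) ∧ v = State.a.run (reflect w)) ?_
    ⟨w, rfl, rfl⟩
  rintro _ _ ⟨w, rfl, rfl⟩
  obtain ⟨x, y, u, rfl⟩ := exists_cons_cons w
  cases x
  · cases y
    · exact ⟨false, true, reflect (State.a.run u), State.a.run (reflect u), by simp, by simp,
        Or.inr ⟨u, rfl, rfl⟩⟩
    · exact ⟨false, false, reflect u, reflect u, by simp, by simp, Or.inl rfl⟩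
  · obtain ⟨v, hv⟩ : ∃ v, reflect (cons true (cons y u)) = cons true (cons y v) := by
      by_cases hc : true = true ∧ y = false ∧ OddZero u
      · obtain ⟨-, rfl, hu⟩ := hc
        exact ⟨_, reflect_of_oddZero hu⟩
      · exact ⟨_, reflect_of_not hc⟩
    exact ⟨true, y, v, v, by simp [hv], by simp [hv], Or.inl rfl⟩

theorem reflect_b_run_of_not_oddZero {w : Word} (hw : ¬ OddZero w) :
    reflect (State.b.run w) = State.b.run (reflect w) := by
  refine eq_of_bisim (fun u v => ∃ w, ¬ OddZero w ∧ u = reflect (State.b.run w) ∧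
    v = State.b.run (reflect w)) ?_ ⟨w, hw, rfl, rfl⟩
  rintro _ _ ⟨w, hw, rfl, rfl⟩
  obtain ⟨x, y, u, rfl⟩ := exists_cons_cons w
  cases y
  · have hu : ¬ OddZero u := by simpa using hw
    have hu' : ¬ OddZero (State.b.run u) := by simpa using hu
    cases x
    · exact ⟨true, false, reflect (State.b.run u), State.b.run (reflect u),
        by simp [reflect_of_not_oddZero _ _ hu'], by simp, Or.inr ⟨u, hu, rfl, rfl⟩⟩
    · exact ⟨false, false, reflect u, reflect u, by simp,
        by simp [reflect_of_not_oddZero _ _ hu], Or.inl rfl⟩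
  · cases x
    · exact ⟨true, true, reflect u, reflect u, by simp, by simp, Or.inl rfl⟩
    · exact ⟨false, true, reflect u, reflect u, by simp, by simp, Or.inl rfl⟩

theorem b_run_reflect {w : Word} (hw : OddZero w) : State.b.run (reflect w) = flipEven w := by
  refine eq_of_bisim (fun u v => ∃ w, OddZero w ∧ u = State.b.run (reflect w) ∧
    v = flipEven w) ?_ ⟨w, hw, rfl, rfl⟩
  rintro _ _ ⟨w, hw, rfl, rfl⟩
  obtain ⟨x, u, hu, rfl⟩ := hw.exists_cons_cons
  cases x
  · exact ⟨true, false, State.b.run (reflect u), flipEven u, by simp, by simp,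
      Or.inr ⟨u, hu, rfl, rfl⟩⟩
  · exact ⟨false, false, flipEven u, flipEven u, by simp [reflect_of_oddZero hu], by simp,
      Or.inl rfl⟩

theorem flipEven_b_run {w : Word} (hw : OddZero w) : flipEven (State.b.run w) = reflect w := by
  refine eq_of_bisim (fun u v => ∃ w, OddZero w ∧ u = flipEven (State.b.run w) ∧
    v = reflect w) ?_ ⟨w, hw, rfl, rfl⟩
  rintro _ _ ⟨w, hw, rfl, rfl⟩
  obtain ⟨x, u, hu, rfl⟩ := hw.exists_cons_cons
  cases x
  · exact ⟨false, false, flipEven (State.b.run u), reflect u, by simp, by simp,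
      Or.inr ⟨u, hu, rfl, rfl⟩⟩
  · exact ⟨true, false, flipEven u, flipEven u, by simp, by simp [reflect_of_oddZero hu],
      Or.inl rfl⟩

/-- On the infinite `b`-orbits, `reflect` conjugates `b` to its inverse: `-(x - 1) - 1 = -x`. -/
theorem b_run_reflect_b_run {w : Word} (hw : OddZero w) :
    State.b.run (reflect (State.b.run w)) = reflect w := by
  rw [b_run_reflect (oddZero_b_run.2 hw), flipEven_b_run hw]

theorem isSymmetry_reflect : IsSymmetry reflect := by
  classical
  refine ⟨reflect_involutive, ?_⟩
  rintro s (rfl | rfl)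
  · exact ⟨reflect, reflect_involutive, fun v => by rw [reflect_a_run]⟩
  · refine ⟨fun v => if OddZero v then reflect (State.b.run v) else reflect v, fun v => ?_,
      fun v => ?_⟩
    · by_cases hv : OddZero v
      · simp [hv, b_run_reflect_b_run, reflect_involutive v]
      · simp [hv, reflect_involutive v]
    · by_cases hv : OddZero v
      · simp [hv, b_run_reflect_b_run, Sym2.eq_swap]
      · simp [hv, reflect_b_run_of_not_oddZero]

theorem isSymmetry_lift_reflect : IsSymmetry (lift reflect) :=
  isSymmetry_reflect.lift reflect_a_run

theorem reflect_b_iterate {w : Word} (hw : OddZero w) (n : ℕ) :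
    State.b.run^[n] (reflect (State.b.run^[n] w)) = reflect w := by
  induction n generalizing w with
  | zero => rfl
  | succ n ih =>
    rw [Function.iterate_succ_apply', Function.iterate_succ_apply State.b.run n w,
      ih (oddZero_b_run.2 hw), b_run_reflect_b_run hw]

theorem reflect_prefix {w : Word} {k : ℕ} (h : ∀ i < 2 * k, w i = false) :
    ∀ i < 2 * k, reflect w i = false := by
  induction k generalizing w with
  | zero => simp
  | succ k ih =>
    obtain ⟨x, y, u, rfl⟩ := exists_cons_cons w
    have hx : x = false := h 0 (by omega)
    have hy : y = false := h 1 (by omega)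
    subst hx hy
    rw [reflect_false]
    rintro (_ | _ | i) hi
    · rfl
    · rfl
    · exact ih (fun j hj => h (j + 2) (by omega)) i (by omega)

/-- If `w q` is a letter `1` at an even index after which the letters at odd indices vanish, then
`reflect` changes exactly the letters at even indices from there on, up to finitely many. -/
theorem reflect_apply_of_gt {w : Word} {q : ℕ} (hq : w (2 * q) = true)
    (h0 : ∀ i ≥ q, w (2 * i + 1) = false) {n : ℕ} (hn : 2 * q < n) :
    reflect w n = if Even n then !(w n) else w n := by
  induction q generalizing w n with
  | zero =>
    obtain ⟨x, y, u, rfl⟩ := exists_cons_cons w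
    have hx : x = true := hq
    have hy : y = false := h0 0 le_rfl
    have hu : OddZero u := fun i => h0 (i + 1) (by omega)
    subst hx hy
    rw [reflect_of_oddZero hu]
    rcases n with _ | _ | n
    · omega
    · simp
    · simp [flipEven, Nat.even_add_one]
  | succ q ih =>
    obtain ⟨x, y, u, rfl⟩ := exists_cons_cons w
    obtain ⟨n, rfl⟩ : ∃ m, n = m + 2 := ⟨n - 2, by omega⟩
    by_cases hc : x = true ∧ y = false ∧ OddZero u
    · obtain ⟨rfl, rfl, hu⟩ := hc
      rw [reflect_of_oddZero hu]
      simp [flipEven, Nat.even_add_one]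
    · rw [reflect_of_not hc]
      have := ih (w := u) hq (fun i hi => h0 (i + 1) (by omega)) (n := n) (by omega)
      simpa [Nat.even_add_one] using this

/-! ### Invariance of the number of ends -/

theorem Ray.equivalent_iff {V : Type*} {G : SimpleGraph V} {r r' : Ray G} :
    r.Equivalent r' ↔ ∀ S : Finset V, ∃ N, ∀ n ≥ N, ∃ (h : r.toFun n ∉ (S : Set V))
      (h' : r'.toFun n ∉ (S : Set V)), G.componentComplMk h = G.componentComplMk h' := by
  constructor
  · intro h S
    obtain ⟨C, N, hN⟩ := h S
    refine ⟨N, fun n hn => ?_⟩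
    obtain ⟨⟨h1, h2⟩, ⟨h3, h4⟩⟩ := hN n hn
    exact ⟨h1, h3, h2.trans h4.symm⟩
  · intro h S
    obtain ⟨C, N, hN⟩ := r.exists_tail S
    obtain ⟨M, hM⟩ := h S
    refine ⟨C, max N M, fun n hn => ?_⟩
    obtain ⟨h1, h2⟩ := hN n (le_of_max_le_left hn)
    obtain ⟨h3, h4, h5⟩ := hM n (le_of_max_le_right hn)
    exact ⟨⟨h1, h2⟩, ⟨h4, h5.symm.trans h2⟩⟩

/-- The image of a ray under a graph isomorphism. -/
def Ray.map {V W : Type*} {G : SimpleGraph V} {H : SimpleGraph W} (f : G ≃g H) (r : Ray G) :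
    Ray H where
  toFun n := f (r.toFun n)
  injective := f.injective.comp r.injective
  adj n := f.map_adj_iff.2 (r.adj n)

theorem Ray.Equivalent.map {V W : Type*} {G : SimpleGraph V} {H : SimpleGraph W} (f : G ≃g H)
    {r r' : Ray G} (h : r.Equivalent r') : (r.map f).Equivalent (r'.map f) := by
  rw [Ray.equivalent_iff] at *
  intro S
  obtain ⟨N, hN⟩ := h (S.map f.symm.toEquiv.toEmbedding)
  refine ⟨N, fun n hn => ?_⟩
  obtain ⟨h1, h2, h3⟩ := hN n hn
  have hS : ∀ v, v ∉ ((S.map f.symm.toEquiv.toEmbedding : Finset V) : Set V) →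
      f v ∉ (S : Set W) := by
    intro v hv hf
    exact hv (by simpa using ⟨f v, hf, f.symm_apply_apply v⟩)
  refine ⟨hS _ h1, hS _ h2, ?_⟩
  let F : G.induce ((S.map f.symm.toEquiv.toEmbedding : Finset V) : Set V)ᶜ →g
      H.induce (S : Set W)ᶜ :=
    { toFun := fun v => ⟨f v, hS _ v.2⟩
      map_rel' := fun {u v} (huv : G.Adj u v) => f.map_adj_iff.2 huv }
  exact congrArg (SimpleGraph.ConnectedComponent.map F) h3

theorem card_end_congr {V W : Type*} {G : SimpleGraph V} {H : SimpleGraph W} (f : G ≃g H) :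
    ENat.card (End G) = ENat.card (End H) := by
  have hinv : ∀ r : Ray G, (r.map f).map f.symm = r := by
    intro r
    cases r
    simp [Ray.map]
  have hinv' : ∀ r : Ray H, (r.map f.symm).map f = r := by
    intro r
    cases r
    simp [Ray.map]
  refine ENat.card_congr (Quotient.congr ⟨Ray.map f, Ray.map f.symm, hinv, hinv'⟩ ?_)
  intro r r'
  refine ⟨fun h => Ray.Equivalent.map f h, fun h => ?_⟩
  have := Ray.Equivalent.map f.symm h
  simpa [hinv] using this

theorem MultigraphIso.adj_iff {α β α' β' : Type*} {G : Graph α β} {H : Graph α' β'}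
    (f : MultigraphIso G H) (x y : G.vertexSet) :
    H.Adj (f.vertexEquiv x) (f.vertexEquiv y) ↔ G.Adj x y := by
  constructor
  · rintro ⟨e, he⟩
    obtain ⟨e', he'⟩ := f.edgeEquiv.surjective ⟨e, he.edge_mem⟩
    exact ⟨e', (f.isLink_iff e' x y).2 (by rw [he']; exact he)⟩
  · rintro ⟨e, he⟩
    exact ⟨_, (f.isLink_iff ⟨e, he.edge_mem⟩ x y).1 he⟩

theorem MultigraphIso.numEnds_eq {α β α' β' : Type*} {G : Graph α β} {H : Graph α' β'}
    (f : MultigraphIso G H) : numEnds G = numEnds H := by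
  refine card_end_congr ⟨f.vertexEquiv, fun {x y} => ?_⟩
  rw [Graph.toSimpleGraph_adj, Graph.toSimpleGraph_adj, f.adj_iff]
  simp

/-! ### Words with letters `1` at infinitely many even and odd indices -/

/-- `x` and `y` are joined by an edge with label `s`, in one of the two directions. -/
def EdgeRel (s : State) (x y : Word) : Prop := y = s.run x ∨ x = s.run y

theorem Γ_adj_iff {ξ x y : Word} (hx : x ∈ MulAction.orbit basilicaGroup ξ) :
    (Γ ξ).Adj x y ↔ EdgeRel .a x y ∨ EdgeRel .b x y := by
  have hinv := orbit_invariant ξ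
  constructor
  · rintro ⟨⟨v, g⟩, -, hg, h⟩
    have h : s(v, g • v) = s(x, y) := h
    have key : ∀ s : State, g.1 = s.perm → EdgeRel s x y := by
      intro s hs
      have hgv : g • v = s.run v := congrArg (fun p : Equiv.Perm Word => p v) hs
      rw [hgv] at h
      rcases Sym2.eq_iff.1 h with ⟨rfl, rfl⟩ | ⟨rfl, rfl⟩
      exacts [Or.inl rfl, Or.inr rfl]
    rcases hg with hg | hg
    · exact Or.inl (key .a (congrArg Subtype.val hg))
    · exact Or.inr (key .b (congrArg Subtype.val hg))
  · rintro ((rfl | rfl) | (rfl | rfl))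
    · exact ⟨(x, genA), hx, Or.inl rfl, rfl⟩
    · exact ⟨(y, genA), (hinv y).1.1 hx, Or.inl rfl, Sym2.eq_swap⟩
    · exact ⟨(x, genB), hx, Or.inr rfl, rfl⟩
    · exact ⟨(y, genB), (hinv y).2.1 hx, Or.inr rfl, Sym2.eq_swap⟩

/-- Two words are joined by a path of labelled edges inside the set `T`. -/
def Joined (T : Set Word) : Word → Word → Prop :=
  Relation.EqvGen fun x y => x ∈ T ∧ y ∈ T ∧ (y = State.a.run x ∨ y = State.b.run x)

theorem joined_a {T : Set Word} {x : Word} (hx : x ∈ T) (hy : State.a.run x ∈ T) :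
    Joined T x (State.a.run x) := .rel _ _ ⟨hx, hy, Or.inl rfl⟩

theorem joined_b {T : Set Word} {x : Word} (hx : x ∈ T) (hy : State.b.run x ∈ T) :
    Joined T x (State.b.run x) := .rel _ _ ⟨hx, hy, Or.inr rfl⟩

theorem Joined.cons_false {T : Set Word} {u v : Word} (h : Joined T u v) :
    Joined {w | tail w ∈ T} (cons false u) (cons false v) := by
  induction h with
  | rel x y h =>
    obtain ⟨hx, hy, rfl | rfl⟩ := h
    · have h1 := joined_b (T := {w | tail w ∈ T}) (x := cons false x) hx (by simpa using hy)
      have h2 := joined_b (T := {w | tail w ∈ T}) (x := cons true (State.a.run x)) hy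
        (by simpa using hy)
      rw [b_run_false] at h1
      rw [b_run_true] at h2
      exact h1.trans _ _ _ h2
    · have h1 := joined_a (T := {w | tail w ∈ T}) (x := cons false x) hx (by simpa using hy)
      rwa [a_run_false] at h1
  | refl x => exact .refl _
  | symm x y _ ih => exact ih.symm
  | trans x y z _ _ ih1 ih2 => exact ih1.trans _ _ _ ih2

theorem joined_cons_false_self {T : Set Word} {u : Word} (hu : u ∈ T) (x : Bool) :
    Joined {w | tail w ∈ T} (cons x u) (cons false u) := by
  cases x
  · exact .refl _
  · have h := joined_b (T := {w | tail w ∈ T}) (x := cons true u) hu (by simpa using hu)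
    rwa [b_run_true] at h

theorem Joined.of_tail_iterate {T : Set Word} (n : ℕ) {u v : Word} (hu : tail^[n] u ∈ T)
    (hv : tail^[n] v ∈ T) (h : Joined T (tail^[n] u) (tail^[n] v)) :
    Joined {w | tail^[n] w ∈ T} u v := by
  induction n generalizing u v with
  | zero => exact h
  | succ n ih =>
    have h1 := (ih (u := tail u) (v := tail v) hu hv h).cons_false
    have h2 := joined_cons_false_self (T := {w | tail^[n] w ∈ T}) (u := tail u) hu (u 0)
    have h3 := joined_cons_false_self (T := {w | tail^[n] w ∈ T}) (u := tail v) hv (v 0)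
    rw [cons_tail] at h2 h3
    exact (h2.trans _ _ _ h1).trans _ _ _ h3.symm

/-- If `w` carries an `a`-loop and its `b`-orbit is finite, then `w` is not a cut vertex: in the
graph without `w`, every vertex of the component of `w` is joined to the rest of the cycle through
`w` formed by the `b`-edges. -/
theorem joined_compl_singleton {w : Word} (h1 : w 0 = true) (h2 : ¬ OddZero w) {v : Word}
    (hv : v ∈ MulAction.orbit basilicaGroup w) (hne : v ≠ w) :
    Joined {w}ᶜ v (State.b.run w) := by
  have ha : State.a.run w = w := (a_run_eq_iff w).2 h1
  have hcycle : ∀ n, State.b.run^[n] (State.b.run w) ≠ w →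
      (∀ m < n, State.b.run^[m] (State.b.run w) ≠ w) →
      Joined {w}ᶜ (State.b.run^[n] (State.b.run w)) (State.b.run w) := by
    intro n
    induction n with
    | zero => exact fun _ _ => .refl _
    | succ n ih =>
      intro hn hlt
      have hn' := hlt n n.lt_succ_self
      have h := ih hn' fun m hm => hlt m (hm.trans n.lt_succ_self)
      rw [Function.iterate_succ_apply'] at hn ⊢
      exact (joined_b hn' hn).symm.trans _ _ _ h
  have hlast : ∀ u, State.b.run u = w → Joined {w}ᶜ u (State.b.run w) := by
    intro u hu
    obtain ⟨n, hn, h⟩ := exists_b_iterate_eq h2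
    have hex : ∃ n, State.b.run^[n] (State.b.run w) = w := by
      refine ⟨n - 1, ?_⟩
      rw [← Function.iterate_succ_apply, Nat.succ_eq_add_one, Nat.sub_add_cancel hn, h]
    classical
    obtain ⟨k, hk⟩ : ∃ k, Nat.find hex = k + 1 := by
      refine Nat.exists_eq_succ_of_ne_zero fun h0 => b_run_ne w ?_
      have := Nat.find_spec hex
      rwa [h0] at this
    have hspec := Nat.find_spec hex
    rw [hk, Function.iterate_succ_apply'] at hspec
    have huk : State.b.run^[k] (State.b.run w) = u := run_injective _ (hspec.trans hu.symm)
    have := hcycle k (Nat.find_min hex (by omega)) fun m hm => Nat.find_min hex (by omega)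
    rwa [huk] at this
  have hinv : Invariant {v | v = w ∨ Joined {w}ᶜ v (State.b.run w)} := by
    intro u
    constructor
    · by_cases hu : u = w
      · simp [hu, ha]
      · have hau : State.a.run u ≠ w := fun h => hu (run_injective .a (h.trans ha.symm))
        have hj := joined_a (T := {w}ᶜ) hu hau
        simp only [Set.mem_ofPred_eq, hu, hau, false_or]
        exact ⟨fun h => hj.trans _ _ _ h, fun h => hj.symm.trans _ _ _ h⟩
    · by_cases hu : u = w
      · rw [hu]
        exact iff_of_true (Or.inr (.refl _)) (Or.inl rfl)
      · by_cases hbu : State.b.run u = w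
        · exact iff_of_true (Or.inl hbu) (Or.inr (hlast u hbu))
        · have hj := joined_b (T := {w}ᶜ) hu hbu
          simp only [Set.mem_ofPred_eq, hu, hbu, false_or]
          exact ⟨fun h => hj.trans _ _ _ h, fun h => hj.symm.trans _ _ _ h⟩
  exact (hinv.orbit_subset (Or.inl rfl) hv).resolve_left hne

theorem tail_iterate_apply (n : ℕ) (w : Word) (i : ℕ) : tail^[n] w i = w (n + i) := by
  induction n generalizing w with
  | zero => simp
  | succ n ih =>
    rw [Function.iterate_succ_apply, ih]
    exact congrArg w (by omega)

theorem Joined.componentComplMk_eq {ξ : Word} {S : Set (Γ ξ).vertexSet} {T : Set Word}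
    (hTS : ∀ v : (Γ ξ).vertexSet, (v : Word) ∈ T → v ∉ S) {u v : (Γ ξ).vertexSet}
    (h : Joined T u v) (hu : u ∉ S) (hv : v ∉ S) :
    (Γ ξ).toSimpleGraph.componentComplMk hu = (Γ ξ).toSimpleGraph.componentComplMk hv := by
  classical
  -- The component of a vertex outside `S`, extended to all words, is constant along edges in `T`.
  let F : Word → Option ((Γ ξ).toSimpleGraph.ComponentCompl S) := fun w =>
    if h : ∃ h : w ∈ (Γ ξ).vertexSet, (⟨w, h⟩ : (Γ ξ).vertexSet) ∉ S then
      some ((Γ ξ).toSimpleGraph.componentComplMk h.choose_spec) else none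
  have hF : ∀ x y, Joined T x y → F x = F y := by
    intro x y h
    induction h with
    | rel x y h =>
      obtain ⟨hx, hy, h⟩ := h
      by_cases hxy : x = y
      · rw [hxy]
      have hiff : x ∈ (Γ ξ).vertexSet ↔ y ∈ (Γ ξ).vertexSet := by
        rcases h with rfl | rfl
        exacts [(orbit_invariant ξ x).1.symm, (orbit_invariant ξ x).2.symm]
      by_cases hxo : x ∈ (Γ ξ).vertexSet
      · have hyo := hiff.1 hxo
        have hx' : ∃ h : x ∈ (Γ ξ).vertexSet, (⟨x, h⟩ : (Γ ξ).vertexSet) ∉ S :=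
          ⟨hxo, hTS ⟨x, hxo⟩ hx⟩
        have hy' : ∃ h : y ∈ (Γ ξ).vertexSet, (⟨y, h⟩ : (Γ ξ).vertexSet) ∉ S :=
          ⟨hyo, hTS ⟨y, hyo⟩ hy⟩
        simp only [F, dif_pos hx', dif_pos hy']
        refine congrArg some (SimpleGraph.componentComplMk_eq_of_adj _ _ _ ?_)
        refine ⟨fun h => hxy (congrArg Subtype.val h), (Γ_adj_iff hxo).2 ?_⟩
        exact h.imp Or.inl Or.inl
      · have hyo := mt hiff.2 hxo
        simp only [F]
        rw [dif_neg fun h => hxo h.fst, dif_neg fun h => hyo h.fst]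
    | refl x => rfl
    | symm x y _ ih => exact ih.symm
    | trans x y z _ _ ih1 ih2 => exact ih1.trans ih2
  have := hF u v h
  have hu' : ∃ h : (u : Word) ∈ (Γ ξ).vertexSet, (⟨u, h⟩ : (Γ ξ).vertexSet) ∉ S := ⟨u.2, hu⟩
  have hv' : ∃ h : (v : Word) ∈ (Γ ξ).vertexSet, (⟨v, h⟩ : (Γ ξ).vertexSet) ∉ S := ⟨v.2, hv⟩
  simp only [F, dif_pos hu', dif_pos hv', Option.some_inj] at this
  exact this

theorem tail_iterate_mem_orbit {ξ v : Word} (h : Cofinal ξ v) (n : ℕ) :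
    tail^[n] v ∈ MulAction.orbit basilicaGroup (tail^[n] ξ) := by
  refine Cofinal.mem_orbit (cofinal_iff.2 ?_)
  obtain ⟨N, hN⟩ := cofinal_iff.1 h
  exact ⟨N, fun m hm => by simpa [tail_iterate_apply] using hN (n + m) (by omega)⟩

/-- If letters `1` occur infinitely often at even and at odd indices, then `Γ_ξ` has at most one
end: the words that differ from `ξ` only before a letter `1` form a finite set whose complement is
connected. -/
theorem subsingleton_end {ξ : Word} (h0 : zeroWord ∉ MulAction.orbit basilicaGroup ξ)
    (h1 : ∀ N, ∃ n ≥ N, ξ (2 * n) = true) (h2 : ∀ N, ∃ n ≥ N, ξ (2 * n + 1) = true) :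
    Subsingleton (End (Γ ξ).toSimpleGraph) := by
  refine ⟨Quotient.ind₂ fun r r' => Quotient.sound ?_⟩
  refine Ray.equivalent_iff.2 fun S => ?_
  have hcof : ∀ v : (Γ ξ).vertexSet, Cofinal ξ v := fun v => cofinal_of_mem_orbit h0 v.2
  have hbound : ∃ N, ∀ v ∈ S, ∀ n ≥ N, (v : Word) n = ξ n := by
    choose f hf using fun v => cofinal_iff.1 (hcof v)
    exact ⟨S.sup f, fun v hv n hn => (hf v n ((Finset.le_sup hv).trans hn)).symm⟩
  obtain ⟨N, hN⟩ := hbound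
  obtain ⟨k, hk, hk1⟩ := h1 N
  set n := 2 * k with hn
  set w := tail^[n] ξ with hw
  have hw0 : w 0 = true := by simpa [hw, tail_iterate_apply] using hk1
  have hwo : ¬ OddZero w := by
    intro h
    obtain ⟨m, hm, hm1⟩ := h2 k
    have := h (m - k)
    rw [hw, tail_iterate_apply, show n + (2 * (m - k) + 1) = 2 * m + 1 by omega, hm1] at this
    cases this
  have hfin : {v : Word | tail^[n] v = w}.Finite := by
    refine Set.Finite.of_injOn (f := fun v (i : Fin n) => v i) (t := Set.univ)
      (fun _ _ => Set.mem_univ _) ?_ Set.finite_univ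
    intro u hu v hv huv
    funext i
    by_cases hi : i < n
    · exact congrFun huv ⟨i, hi⟩
    · have := congrFun (hu.trans hv.symm : tail^[n] u = tail^[n] v) (i - n)
      rwa [tail_iterate_apply, tail_iterate_apply, show n + (i - n) = i by omega] at this
  have htail : ∀ r : Ray (Γ ξ).toSimpleGraph, ∃ M, ∀ m ≥ M,
      tail^[n] (r.toFun m : Word) ∈ ({w}ᶜ : Set Word) := by
    intro r
    have hinj : Function.Injective fun m => (r.toFun m : Word) :=
      Subtype.val_injective.comp r.injective
    obtain ⟨M, hM⟩ := (hfin.preimage hinj.injOn).bddAbove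
    exact ⟨M + 1, fun m hm h => absurd (hM h) (by omega)⟩
  have hTS : ∀ v : (Γ ξ).vertexSet, (v : Word) ∈ {u | tail^[n] u ∈ ({w}ᶜ : Set Word)} →
      v ∉ (S : Set (Γ ξ).vertexSet) := by
    intro v hv hvS
    refine hv (funext fun i => ?_)
    rw [hw, tail_iterate_apply, tail_iterate_apply]
    exact hN v hvS _ (by omega)
  obtain ⟨M, hM⟩ := htail r
  obtain ⟨M', hM'⟩ := htail r'
  refine ⟨max M M', fun m hm => ?_⟩
  have h3 := hM m (le_of_max_le_left hm)
  have h4 := hM' m (le_of_max_le_right hm)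
  refine ⟨hTS _ h3, hTS _ h4, Joined.componentComplMk_eq hTS ?_ _ _⟩
  refine Joined.of_tail_iterate n h3 h4 ?_
  have h5 := joined_compl_singleton hw0 hwo (tail_iterate_mem_orbit (hcof _) n) h3
  have h6 := joined_compl_singleton hw0 hwo (tail_iterate_mem_orbit (hcof _) n) h4
  exact h5.trans _ _ _ h6.symm

/-! ### The orbit of `000…` -/

theorem zeroWord_eq_cons : zeroWord = cons false zeroWord := (cons_tail zeroWord).symm

theorem ab_run_zeroWord (n : ℕ) :
    State.a.run zeroWord n = decide (Odd n) ∧ State.b.run zeroWord n = decide (Even n) := by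
  induction n with
  | zero => exact ⟨rfl, rfl⟩
  | succ n ih =>
    rw [zeroWord_eq_cons]
    simp [ih, Nat.odd_add_one, Nat.even_add_one]

theorem reflect_zeroWord : reflect zeroWord = zeroWord := by
  have h0 : zeroWord = cons false (cons false zeroWord) := by
    rw [← zeroWord_eq_cons, ← zeroWord_eq_cons]
  refine eq_of_bisim (fun u v => u = reflect v ∧ v = zeroWord) ?_ ⟨rfl, rfl⟩
  rintro _ _ ⟨rfl, rfl⟩
  refine ⟨false, false, reflect zeroWord, zeroWord, ?_, h0, Or.inr ⟨rfl, rfl⟩⟩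
  rw [← reflect_false, ← h0]

/-- A path avoiding `000…` stays in one cofinality class. -/
theorem cofinal_of_componentComplMk_eq {ξ : Word} {S : Set (Γ ξ).vertexSet}
    (hS : ∀ v, v ∉ S → (v : Word) ≠ zeroWord) {u v : (Γ ξ).vertexSet} (hu : u ∉ S) (hv : v ∉ S)
    (h : (Γ ξ).toSimpleGraph.componentComplMk hu = (Γ ξ).toSimpleGraph.componentComplMk hv) :
    Cofinal u v := by
  have h := SimpleGraph.ConnectedComponent.eq.1 h
  rw [SimpleGraph.reachable_iff_reflTransGen] at h
  suffices ∀ x : (Sᶜ : Set (Γ ξ).vertexSet), Relation.ReflTransGen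
      ((Γ ξ).toSimpleGraph.induce Sᶜ).Adj ⟨u, hu⟩ x → Cofinal u (x.1 : Word) from this _ h
  intro x hx
  induction hx with
  | refl => exact cofinal_iff.2 ⟨0, fun _ _ => rfl⟩
  | @tail y z _ hyz ih =>
    refine ih.trans ?_
    have hadj : (Γ ξ).toSimpleGraph.Adj y z := hyz
    rcases (Γ_adj_iff y.1.2).1 hadj.2 with (h | h) | (h | h)
    · rw [h]
      exact (cofinal_run _ (hS _ y.2)).symm
    · rw [h]
      exact cofinal_run _ (hS _ z.2)
    · rw [h]
      exact (cofinal_run _ (hS _ y.2)).symm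
    · rw [h]
      exact cofinal_run _ (hS _ z.2)

/-- An injective sequence of words in the orbit of `ξ`, consecutive ones being joined by an edge,
is a ray of `Γ_ξ`. -/
def rayOf {ξ : Word} (f : ℕ → Word) (h0 : ∀ n, f n ∈ MulAction.orbit basilicaGroup ξ)
    (hinj : f.Injective) (hf : ∀ n, EdgeRel .a (f n) (f (n + 1)) ∨ EdgeRel .b (f n) (f (n + 1))) :
    Ray (Γ ξ).toSimpleGraph where
  toFun n := ⟨f n, h0 n⟩
  injective m n h := hinj (congrArg Subtype.val h)
  adj n := ⟨fun h => by simpa using hinj (congrArg Subtype.val h), (Γ_adj_iff (h0 n)).2 (hf n)⟩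

/-- The graph of the orbit of `000…` has more than two ends: the vertex `000…` separates three
cofinality classes, each of which contains a ray. -/
theorem three_le_card_end {ξ : Word} (h : zeroWord ∈ MulAction.orbit basilicaGroup ξ) :
    3 ≤ ENat.card (End (Γ ξ).toSimpleGraph) := by
  set O := MulAction.orbit basilicaGroup ξ with hO
  have hinv : Invariant O := orbit_invariant ξ
  have hbO : ∀ n, State.b.run^[n] zeroWord ∈ O := by
    intro n
    induction n with
    | zero => exact h
    | succ n ih =>
      rw [Function.iterate_succ_apply']
      exact (hinv _).2.2 ih
  have haO : ∀ n, State.a.run^[n] zeroWord ∈ O := by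
    intro n
    induction n with
    | zero => exact h
    | succ n ih =>
      rw [Function.iterate_succ_apply']
      exact (hinv _).1.2 ih
  have hzero := oddZero_zeroWord
  have hodd : ∀ n, OddZero (State.b.run^[n] zeroWord) := fun n =>
    (oddZero_b_iterate n).2 hzero
  have hcO : ∀ n, reflect (State.b.run^[n] zeroWord) ∈ O := by
    intro n
    induction n with
    | zero =>
      simpa [reflect_zeroWord] using h
    | succ n ih =>
      rw [Function.iterate_succ_apply', ← (hinv _).2, b_run_reflect_b_run (hodd n)]
      exact ih
  have hbinj := hzero.b_iterate_injective
  have hacons : ∀ n, State.a.run^[n] zeroWord = cons false (State.b.run^[n] zeroWord) := by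
    intro n
    induction n with
    | zero => exact zeroWord_eq_cons
    | succ n ih => rw [Function.iterate_succ_apply', ih, a_run_false, Function.iterate_succ_apply']
  have hainj : Function.Injective fun n : ℕ => State.a.run^[n] zeroWord := by
    intro m n hmn
    simp only [hacons, cons_inj, true_and] at hmn
    exact hbinj hmn
  have hne : ∀ n, State.b.run^[n + 1] zeroWord ≠ zeroWord := fun n hn => by
    simpa using hbinj (show State.b.run^[n + 1] zeroWord = State.b.run^[0] zeroWord from hn)
  let rb : Ray (Γ ξ).toSimpleGraph := rayOf (fun n => State.b.run^[n + 1] zeroWord)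
    (fun n => hbO _) (fun m n hmn => by simpa using hbinj hmn)
    (fun n => Or.inr (Or.inl (Function.iterate_succ_apply' _ _ _)))
  let ra : Ray (Γ ξ).toSimpleGraph := rayOf (fun n => State.a.run^[n + 1] zeroWord)
    (fun n => haO _) (fun m n hmn => by simpa using hainj hmn)
    (fun n => Or.inl (Or.inl (Function.iterate_succ_apply' _ _ _)))
  let rc : Ray (Γ ξ).toSimpleGraph := rayOf (fun n => reflect (State.b.run^[n] zeroWord))
    (fun n => hcO _) (fun m n hmn => hbinj (reflect_involutive.injective hmn))
    (fun n => Or.inr (Or.inr (by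
      rw [Function.iterate_succ_apply', b_run_reflect_b_run (hodd n)])))
  have hb : ∀ n, Cofinal (State.b.run zeroWord) (rb.toFun n) := by
    intro n
    induction n with
    | zero => exact cofinal_iff.2 ⟨0, fun _ _ => rfl⟩
    | succ n ih =>
      refine ih.trans (Cofinal.symm ?_)
      change Cofinal (State.b.run^[n + 1 + 1] zeroWord) (State.b.run^[n + 1] zeroWord)
      rw [Function.iterate_succ_apply']
      exact cofinal_run _ (hne n)
  have ha : ∀ n, Cofinal (State.a.run zeroWord) (ra.toFun n) := by
    intro n
    induction n with
    | zero => exact cofinal_iff.2 ⟨0, fun _ _ => rfl⟩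
    | succ n ih =>
      refine ih.trans (Cofinal.symm ?_)
      change Cofinal (State.a.run^[n + 1 + 1] zeroWord) (State.a.run^[n + 1] zeroWord)
      rw [Function.iterate_succ_apply']
      refine cofinal_run _ fun hn => ?_
      simpa using hainj (show State.a.run^[n + 1] zeroWord = State.a.run^[0] zeroWord from hn)
  have hc : ∀ n, Cofinal zeroWord (rc.toFun n) := by
    intro n
    induction n with
    | zero => exact cofinal_iff.2 ⟨0, fun _ _ => by
        change _ = reflect zeroWord _
        rw [reflect_zeroWord]⟩
    | succ n ih =>
      refine ih.trans ?_
      change Cofinal (reflect (State.b.run^[n] zeroWord)) (reflect (State.b.run^[n + 1] zeroWord))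
      rw [← b_run_reflect_b_run (hodd n), ← Function.iterate_succ_apply' State.b.run]
      refine cofinal_run _ fun hn => hne n ?_
      rw [← reflect_involutive (State.b.run^[n + 1] zeroWord), hn, reflect_zeroWord]
  have hsep : ∀ r r' : Ray (Γ ξ).toSimpleGraph, ∀ c c' : Word, (∀ n, Cofinal c (r.toFun n)) →
      (∀ n, Cofinal c' (r'.toFun n)) → (Quotient.mk _ r : End (Γ ξ).toSimpleGraph) =
        Quotient.mk _ r' → Cofinal c c' := by
    intro r r' c c' hr hr' hrr'
    obtain ⟨N, hN⟩ := Ray.equivalent_iff.1 (Quotient.exact hrr') {⟨zeroWord, h⟩}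
    obtain ⟨h1, h2, h3⟩ := hN N le_rfl
    refine (hr N).trans (Cofinal.trans ?_ (hr' N).symm)
    refine cofinal_of_componentComplMk_eq (fun v hv hv0 => hv ?_) h1 h2 h3
    simpa using Subtype.ext hv0
  have hba : ¬ Cofinal (State.b.run zeroWord) (State.a.run zeroWord) := by
    intro hcof
    obtain ⟨N, hN⟩ := cofinal_iff.1 hcof
    have := hN (2 * N) (by omega)
    simp [ab_run_zeroWord, Nat.odd_iff] at this
  have hbc : ¬ Cofinal (State.b.run zeroWord) zeroWord := by
    intro hcof
    obtain ⟨N, hN⟩ := cofinal_iff.1 hcof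
    have := hN (2 * N) (by omega)
    simp [ab_run_zeroWord, zeroWord] at this
  have hac : ¬ Cofinal (State.a.run zeroWord) zeroWord := by
    intro hcof
    obtain ⟨N, hN⟩ := cofinal_iff.1 hcof
    have := hN (2 * N + 1) (by omega)
    simp [ab_run_zeroWord, zeroWord] at this
  have n1 := mt (hsep rb ra _ _ hb ha) hba
  have n2 := mt (hsep rb rc _ _ hb hc) hbc
  have n3 := mt (hsep ra rc _ _ ha hc) hac
  have hinj : Function.Injective (![Quotient.mk _ rb, Quotient.mk _ ra, Quotient.mk _ rc] :
      Fin 3 → End (Γ ξ).toSimpleGraph) := by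
    intro i j hij
    fin_cases i <;> fin_cases j <;> first | rfl | (exfalso; revert hij)
    exacts [n1, n2, fun h => n1 h.symm, n3, fun h => n2 h.symm, fun h => n3 h.symm]
  have := ENat.card_le_card_of_injective hinj
  simpa using this

/-! ### Rigidity of isomorphisms -/

/-- A bijection between two sets of words which preserves the edges together with their labels, but
not necessarily their directions. -/
structure IsLabelIso (φ : Word → Word) (C D : Set Word) : Prop where
  bijOn : Set.BijOn φ C D
  edgeRel_a : ∀ x ∈ C, ∀ y ∈ C, (EdgeRel .a (φ x) (φ y) ↔ EdgeRel .a x y)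
  edgeRel_b : ∀ x ∈ C, ∀ y ∈ C, (EdgeRel .b (φ x) (φ y) ↔ EdgeRel .b x y)

theorem edgeRel_a_self {x : Word} : EdgeRel .a x x ↔ x 0 = true := by
  rw [← a_run_eq_iff, EdgeRel, or_self, eq_comm]

theorem not_edgeRel_b_self (x : Word) : ¬ EdgeRel .b x x := by
  rintro (h | h) <;> exact b_run_ne x h.symm

/-- The labels of the edges can be recovered from the first letters of the endpoints. -/
theorem edgeRel_a_iff {x y : Word} :
    EdgeRel .a x y ↔ (EdgeRel .a x y ∨ EdgeRel .b x y) ∧ x 0 = y 0 := by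
  constructor
  · rintro (rfl | rfl)
    exacts [⟨Or.inl (Or.inl rfl), rfl⟩, ⟨Or.inl (Or.inr rfl), rfl⟩]
  · rintro ⟨h | rfl | rfl, h0⟩
    · exact h
    · simp [b_run_zero] at h0
    · simp [b_run_zero] at h0

theorem edgeRel_b_iff {x y : Word} :
    EdgeRel .b x y ↔ (EdgeRel .a x y ∨ EdgeRel .b x y) ∧ x 0 ≠ y 0 := by
  constructor
  · rintro (rfl | rfl)
    · exact ⟨Or.inr (Or.inl rfl), by simp [b_run_zero]⟩
    · exact ⟨Or.inr (Or.inr rfl), by simp [b_run_zero]⟩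
  · rintro ⟨(rfl | rfl) | h, h0⟩
    · exact absurd rfl h0
    · exact absurd rfl h0
    · exact h

/-- An isomorphism of the unlabelled graphs respects the labels: the loops distinguish the vertices
with first letter `1`, every `b`-edge joins vertices with different first letters and every `a`-edge
joins vertices with the same first letter. -/
theorem MultigraphIso.exists_isLabelIso {ξ η : Word} (f : MultigraphIso (Γ ξ) (Γ η)) :
    ∃ φ, IsLabelIso φ (MulAction.orbit basilicaGroup ξ) (MulAction.orbit basilicaGroup η) := by
  classical
  set φ : Word → Word := fun w =>
    if h : w ∈ (Γ ξ).vertexSet then f.vertexEquiv ⟨w, h⟩ else w with hφ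
  have hφ' : ∀ w (h : w ∈ (Γ ξ).vertexSet), φ w = f.vertexEquiv ⟨w, h⟩ := fun w h => dif_pos h
  have hmaps : ∀ w ∈ (Γ ξ).vertexSet, φ w ∈ (Γ η).vertexSet := fun w h => by
    rw [hφ' w h]
    exact (f.vertexEquiv ⟨w, h⟩).2
  have hadj : ∀ x ∈ (Γ ξ).vertexSet, ∀ y ∈ (Γ ξ).vertexSet,
      (EdgeRel .a (φ x) (φ y) ∨ EdgeRel .b (φ x) (φ y) ↔ EdgeRel .a x y ∨ EdgeRel .b x y) := by
    intro x hx y hy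
    rw [← Γ_adj_iff hx, ← Γ_adj_iff (hmaps x hx), hφ' x hx, hφ' y hy]
    exact f.adj_iff ⟨x, hx⟩ ⟨y, hy⟩
  have hzero : ∀ x ∈ (Γ ξ).vertexSet, φ x 0 = x 0 := by
    intro x hx
    have := hadj x hx x hx
    simp only [not_edgeRel_b_self, or_false, edgeRel_a_self] at this
    exact Bool.eq_iff_iff.2 this
  refine ⟨φ, ⟨hmaps, ?_, ?_⟩, ?_, ?_⟩
  · intro x hx y hy hxy
    rw [hφ' x hx, hφ' y hy] at hxy
    exact congrArg Subtype.val (f.vertexEquiv.injective (Subtype.ext hxy))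
  · intro y hy
    obtain ⟨⟨x, hx⟩, h⟩ := f.vertexEquiv.surjective ⟨y, hy⟩
    exact ⟨x, hx, by rw [hφ' x hx, h]⟩
  · intro x hx y hy
    rw [edgeRel_a_iff, edgeRel_a_iff (x := x), hadj x hx y hy, hzero x hx, hzero y hy]
  · intro x hx y hy
    rw [edgeRel_b_iff, edgeRel_b_iff (x := x), hadj x hx y hy, hzero x hx, hzero y hy]

theorem IsLabelIso.apply_zero {φ : Word → Word} {C D : Set Word} (h : IsLabelIso φ C D) {x : Word}
    (hx : x ∈ C) : φ x 0 = x 0 :=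
  Bool.eq_iff_iff.2 (by rw [← edgeRel_a_self, ← edgeRel_a_self, h.edgeRel_a x hx x hx])

/-- The `a`-edges of a graph in terms of the `b`-edges of the graph whose vertices carry one more
letter: the vertex subdividing an `a`-edge has the two ends of that edge as its neighbours. -/
theorem edgeRel_a_iff_exists {C : Set Word} (hC : Invariant C) {u v : Word}
    (hu : cons false u ∈ C) (hv : cons false v ∈ C) :
    EdgeRel .a u v ↔ ∃ z, cons true z ∈ C ∧ ∀ w, cons false w ∈ C →
      (EdgeRel .b (cons true z) (cons false w) ↔ w = u ∨ w = v) := by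
  have hb : ∀ z w, EdgeRel .b (cons true z) (cons false w) ↔ w = z ∨ State.a.run w = z := by
    intro z w
    simp [EdgeRel, eq_comm]
  have h10 : ∀ w, cons true w ∈ C ↔ cons false w ∈ C := fun w => by
    simpa using (hC (cons true w)).2.symm
  have haC : ∀ w, cons false (State.a.run w) ∈ C ↔ cons false w ∈ C := fun w => by
    rw [← h10]
    simpa using (hC (cons false w)).2
  simp only [hb]
  constructor
  · rintro (rfl | rfl)
    · exact ⟨State.a.run u, (h10 _).2 hv, fun w _ => by rw [run_inj, or_comm]⟩
    · exact ⟨State.a.run v, (h10 _).2 hu, fun w _ => by rw [run_inj]⟩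
  · rintro ⟨z, hz, h⟩
    obtain ⟨t, rfl⟩ := exists_run_eq .a z
    rw [h10] at hz
    have h1 := (h _ hz).1 (Or.inl rfl)
    have h2 := (h t ((haC t).1 hz)).1 (Or.inr rfl)
    have h3 := (h u hu).2 (Or.inl rfl)
    have h4 := (h v hv).2 (Or.inr rfl)
    rw [run_inj] at h3 h4
    simp only [EdgeRel]
    grind

/-- A label preserving bijection induces one between the sets of tails of the words with first
letter `0`. -/
theorem IsLabelIso.descend {φ : Word → Word} {C D : Set Word} (h : IsLabelIso φ C D)
    (hC : Invariant C) (hD : Invariant D) :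
    IsLabelIso (fun w => tail (φ (cons false w))) {w | cons false w ∈ C}
      {w | cons false w ∈ D} := by
  have hcons : ∀ x w, cons x w ∈ C → φ (cons x w) = cons x (tail (φ (cons x w))) := by
    intro x w hw
    conv_lhs => rw [← cons_tail (φ (cons x w)), h.apply_zero hw, cons_zero]
  have hmaps : ∀ w, cons false w ∈ C → cons false (tail (φ (cons false w))) ∈ D := by
    intro w hw
    rw [← hcons false w hw]
    exact h.bijOn.mapsTo hw
  have hsurj : ∀ x u, cons x u ∈ D → ∃ w, cons x w ∈ C ∧ φ (cons x w) = cons x u := by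
    intro x u hu
    obtain ⟨v, hv, hvu⟩ := h.bijOn.surjOn hu
    have h0 := h.apply_zero hv
    rw [hvu, cons_zero] at h0
    refine ⟨tail v, ?_⟩
    rw [h0, cons_tail]
    exact ⟨hv, by rw [hvu, h0]⟩
  have hinj : ∀ u v, cons false u ∈ C → cons false v ∈ C →
      (tail (φ (cons false u)) = tail (φ (cons false v)) ↔ u = v) := by
    intro u v hu hv
    refine ⟨fun huv => ?_, fun huv => by rw [huv]⟩
    have := h.bijOn.injOn hu hv (by rw [hcons _ u hu, hcons _ v hv, huv])
    exact (cons_inj.1 this).2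
  refine ⟨⟨hmaps, fun u hu v hv => (hinj u v hu hv).1, fun u hu => ?_⟩, ?_, ?_⟩
  · obtain ⟨w, hw, hwu⟩ := hsurj false u hu
    exact ⟨w, hw, by simp [hwu]⟩
  · intro u hu v hv
    rw [edgeRel_a_iff_exists hD (hmaps u hu) (hmaps v hv), edgeRel_a_iff_exists hC hu hv]
    constructor
    · rintro ⟨z, hz, hzw⟩
      obtain ⟨y, hy, hyz⟩ := hsurj true z hz
      refine ⟨y, hy, fun w hw => ?_⟩
      have := hzw _ (hmaps w hw)
      rwa [← hcons false w hw, ← hyz, h.edgeRel_b _ hy _ hw, hinj w u hw hu, hinj w v hw hv] at this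
    · rintro ⟨z, hz, hzw⟩
      refine ⟨tail (φ (cons true z)), ?_, fun w hw => ?_⟩
      · rw [← hcons true z hz]
        exact h.bijOn.mapsTo hz
      · obtain ⟨y, hy, hyw⟩ := hsurj false w hw
        have hyw' : w = tail (φ (cons false y)) := by simp [hyw]
        rw [← hcons true z hz, ← hyw, h.edgeRel_b _ hz _ hy, hzw y hy, hyw', hinj y u hy hu,
          hinj y v hy hv]
  · intro u hu v hv
    have hab : ∀ p q : Word, EdgeRel .b p q ↔ EdgeRel .a (cons false p) (cons false q) := by
      simp [EdgeRel]
    rw [hab, hab, ← hcons false u hu, ← hcons false v hv, h.edgeRel_a _ hu _ hv]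

theorem Invariant.tail {C : Set Word} (hC : Invariant C) : Invariant {w | cons false w ∈ C} := by
  have h10 : ∀ w, cons true w ∈ C ↔ cons false w ∈ C := fun w => by
    simpa using (hC (cons true w)).2.symm
  intro w
  constructor
  · change cons false (State.a.run w) ∈ C ↔ cons false w ∈ C
    rw [← h10]
    simpa using (hC (cons false w)).2
  · simpa using (hC (cons false w)).1

theorem IsLabelIso.prefix_iff {φ : Word → Word} {C D : Set Word} (h : IsLabelIso φ C D)
    (hC : Invariant C) (hD : Invariant D) (n : ℕ) {x : Word} (hx : x ∈ C) :
    (∀ i < n, φ x i = false) ↔ ∀ i < n, x i = false := by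
  induction n generalizing φ C D x with
  | zero => simp
  | succ n ih =>
    have hall : ∀ w : Word, (∀ i < n + 1, w i = false) ↔ w 0 = false ∧ ∀ i < n, tail w i = false :=
      fun w => by
        constructor
        · exact fun hw => ⟨hw 0 (by omega), fun i hi => hw (i + 1) (by omega)⟩
        · rintro ⟨h0, h1⟩ (_ | i) hi
          exacts [h0, h1 i (by omega)]
    rw [hall, hall, h.apply_zero hx]
    refine and_congr_right fun h0 => ?_
    have hx0 : cons false (Basilica.tail x) = x := by rw [← h0, cons_tail]
    have := ih (h.descend hC hD) hC.tail hD.tail (x := Basilica.tail x)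
      (show cons false (Basilica.tail x) ∈ C by rwa [hx0])
    rwa [hx0] at this

/-- A path of distinct vertices along `b`-edges follows the edges in one direction. -/
theorem forall_eq_b_iterate_or {f : ℕ → Word} (hf : f.Injective)
    (h : ∀ n, EdgeRel .b (f n) (f (n + 1))) :
    (∀ n, f n = State.b.run^[n] (f 0)) ∨ ∀ n, State.b.run^[n] (f n) = f 0 := by
  have hne : ∀ n, f n ≠ f (n + 2) := fun n hn => by simpa using hf hn
  rcases h 0 with h0 | h0
  · left
    have hstep : ∀ n, f (n + 1) = State.b.run (f n) := by
      intro n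
      induction n with
      | zero => exact h0
      | succ n ih =>
        refine (h (n + 1)).resolve_right fun h' => hne n ?_
        exact run_injective .b (ih.symm.trans h')
    intro n
    induction n with
    | zero => rfl
    | succ n ih => rw [Function.iterate_succ_apply', ← ih, hstep]
  · right
    have hstep : ∀ n, f n = State.b.run (f (n + 1)) := by
      intro n
      induction n with
      | zero => exact h0
      | succ n ih => exact (h (n + 1)).resolve_left fun h' => hne n (ih.trans h'.symm)
    intro n
    induction n with
    | zero => rfl
    | succ n ih => rw [Function.iterate_succ_apply, ← hstep, ih]

theorem iterate_congr_prefix (s : State) (m : ℕ) {u v : Word} {n : ℕ} (h : ∀ i < n, u i = v i) :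
    ∀ i < n, s.run^[m] u i = s.run^[m] v i := by
  induction m with
  | zero => exact h
  | succ m ih =>
    rw [Function.iterate_succ_apply', Function.iterate_succ_apply']
    exact run_congr_prefix s ih

theorem congr_prefix_of_iterate (s : State) (m : ℕ) {u v : Word} {n : ℕ}
    (h : ∀ i < n, s.run^[m] u i = s.run^[m] v i) : ∀ i < n, u i = v i := by
  induction m with
  | zero => exact h
  | succ m ih =>
    rw [Function.iterate_succ_apply', Function.iterate_succ_apply'] at h
    have := runInv_congr_prefix s h
    rw [State.runInv_run, State.runInv_run] at this
    exact ih this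

/-- An infinite `b`-orbit is mapped to an infinite `b`-orbit by a translation or a reflection, and
since the number of leading zeros is preserved, there is only one translation and one reflection
possible. -/
theorem IsLabelIso.mem_or_reflect_mem {φ : Word → Word} {C D : Set Word} (h : IsLabelIso φ C D)
    (hC : Invariant C) (hD : Invariant D) {x : Word} (hx : x ∈ C) (hx0 : OddZero x) :
    x ∈ D ∨ reflect x ∈ D := by
  have hbC : ∀ n, State.b.run^[n] x ∈ C := by
    intro n
    induction n with
    | zero => exact hx
    | succ n ih =>
      rw [Function.iterate_succ_apply']
      exact (hC _).2.2 ih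
  have hinj : Function.Injective fun n : ℕ => φ (State.b.run^[n] x) := fun m n hmn =>
    hx0.b_iterate_injective (h.bijOn.injOn (hbC m) (hbC n) hmn)
  have hedge : ∀ n, EdgeRel .b (φ (State.b.run^[n] x)) (φ (State.b.run^[n + 1] x)) := fun n =>
    (h.edgeRel_b _ (hbC n) _ (hbC (n + 1))).2 (Or.inl (Function.iterate_succ_apply' _ _ _))
  have heq : ∀ u v : Word, (∀ k, ∀ i < 2 * k, u i = v i) → u = v := fun u v huv =>
    funext fun i => huv (i + 1) i (by omega)
  have hφx := h.bijOn.mapsTo hx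
  rcases forall_eq_b_iterate_or hinj hedge with hn | hn
  · -- A translation: `b^m x` and `b^m (φ x)` have a common prefix of length `2 k`.
    left
    convert hφx
    refine heq _ _ fun k => ?_
    obtain ⟨m, hm⟩ := hx0.exists_b_iterate_prefix k
    have hm' := (h.prefix_iff hC hD (2 * k) (hbC m)).2 hm
    rw [show φ (State.b.run^[m] x) = State.b.run^[m] (φ x) from hn m] at hm'
    exact congr_prefix_of_iterate .b m fun i hi => (hm i hi).trans (hm' i hi).symm
  · -- A reflection: `b^m` maps `φ (b^m x)` to `φ x`, and `reflect (b^m x)` to `reflect x`.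
    right
    convert hφx
    refine heq _ _ fun k => ?_
    obtain ⟨m, hm⟩ := hx0.exists_b_iterate_prefix k
    have hm' := (h.prefix_iff hC hD (2 * k) (hbC m)).2 hm
    have hm'' := reflect_prefix hm
    have := iterate_congr_prefix .b m fun i hi => (hm'' i hi).trans (hm' i hi).symm
    rw [reflect_b_iterate hx0] at this
    exact fun i hi => (this i hi).trans (congrFun (hn m) i)

/-! ### Words whose graph has two ends -/

theorem zeroWord_notMem_orbit {ξ : Word} (hξ : ξ ∈ E 2) :
    zeroWord ∉ MulAction.orbit basilicaGroup ξ := by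
  intro h
  have h2 : ENat.card (End (Γ ξ).toSimpleGraph) = ((2 : ℕ) : ℕ∞) := hξ
  have h3 := three_le_card_end h
  rw [h2] at h3
  exact absurd h3 (by decide)

theorem exists_ge_eq_true {ξ : Word} (hξ : ξ ∈ E 2) (N : ℕ) : ∃ n ≥ N, ξ n = true := by
  by_contra! h
  refine zeroWord_notMem_orbit hξ (Cofinal.mem_orbit (cofinal_iff.2 ⟨N, fun n hn => ?_⟩))
  exact Bool.eq_false_iff.2 (h n hn)

/-- If `Γ_ξ` has two ends, then the letters at the indices of one parity finally vanish. -/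
theorem exists_parity_eventually_false {ξ : Word} (hξ : ξ ∈ E 2) :
    ∃ p N : ℕ, ∀ n ≥ N, n % 2 = p % 2 → ξ n = false := by
  have h2 : ENat.card (End (Γ ξ).toSimpleGraph) = ((2 : ℕ) : ℕ∞) := hξ
  have hns : ¬ Subsingleton (End (Γ ξ).toSimpleGraph) := by
    intro h
    have := (ENat.card_le_one_iff_subsingleton _).2 h
    rw [h2] at this
    exact absurd this (by decide)
  by_contra! h
  refine hns (subsingleton_end (zeroWord_notMem_orbit hξ) (fun N => ?_) fun N => ?_)
  · obtain ⟨n, hn, hp, h1⟩ := h 0 (2 * N)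
    refine ⟨n / 2, by omega, ?_⟩
    rw [show 2 * (n / 2) = n by omega]
    simpa using h1
  · obtain ⟨n, hn, hp, h1⟩ := h 1 (2 * N)
    refine ⟨n / 2, by omega, ?_⟩
    rw [show 2 * (n / 2) + 1 = n by omega]
    simpa using h1

/-- Between two letters `1` whose indices have different parities there is a subword `1 0^k 1` with
`k` even. -/
theorem exists_endsInEvenBlock {ξ : Word} {i j : ℕ} (hij : i < j) (hpar : i % 2 ≠ j % 2)
    (hi : ξ i = true) (hj : ξ j = true) : ∃ m ≥ i + 2, EndsInEvenBlock ξ m := by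
  induction h : j - i using Nat.strong_induction_on generalizing i j with
  | _ d ih =>
    by_cases hz : ∀ t, i < t → t < j → ξ t = false
    · refine ⟨j + 1, by omega, i, j - i - 1, ?_, by omega, hi, fun t h1 h2 => hz t h1 (by omega), ?_⟩
      · rw [Nat.even_iff]
        omega
      · rwa [show i + (j - i - 1) + 1 = j by omega]
    · push Not at hz
      obtain ⟨t, hit, htj, ht⟩ := hz
      simp only [ne_eq, Bool.not_eq_false] at ht
      by_cases hpt : t % 2 = j % 2
      · exact ih (t - i) (by omega) hit (by omega) hi ht rfl
      · obtain ⟨m, hm, hm'⟩ := ih (j - t) (by omega) htj hpt ht hj rfl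
        exact ⟨m, by omega, hm'⟩

theorem exists_isRelevantPrefixLength {ξ : Word} (hξ : ξ ∈ E 2) :
    ∃ m, IsRelevantPrefixLength ξ m := by
  by_cases h0 : ∀ i, ξ (2 * i) = false
  · exact ⟨0, Or.inl ⟨h0, rfl⟩⟩
  by_cases h1 : ∀ i, ξ (2 * i + 1) = false
  · exact ⟨1, Or.inr (Or.inl ⟨h1, h0, rfl⟩)⟩
  have hne : {m | EndsInEvenBlock ξ m}.Nonempty := by
    push Not at h0 h1
    obtain ⟨i, hi⟩ := h0
    obtain ⟨j, hj⟩ := h1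
    simp only [ne_eq, Bool.not_eq_false] at hi hj
    rcases lt_or_ge (2 * i) (2 * j + 1) with h | h
    · obtain ⟨m, -, hm⟩ := exists_endsInEvenBlock h (by omega) hi hj
      exact ⟨m, hm⟩
    · obtain ⟨m, -, hm⟩ := exists_endsInEvenBlock (by omega : 2 * j + 1 < 2 * i) (by omega) hj hi
      exact ⟨m, hm⟩
  obtain ⟨p, N, hN⟩ := exists_parity_eventually_false hξ
  obtain ⟨M, hM, hM1⟩ := exists_ge_eq_true hξ N
  have hbdd : BddAbove {m | EndsInEvenBlock ξ m} := by
    refine ⟨M + 1, ?_⟩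
    rintro _ ⟨j, k, ⟨l, rfl⟩, rfl, hj, hz, hk⟩
    by_contra hlt
    -- One of the two letters `1` of the block is at an index of parity `p`, hence before `N ≤ M`.
    have hjN : j < N := by
      by_contra hjN
      by_cases hp : j % 2 = p % 2
      · simp [hN j (by omega) hp] at hj
      · simp [hN (j + (l + l) + 1) (by omega) (by omega)] at hk
    have := hz M (by omega) (by omega)
    simp [hM1] at this
  have hfin := Set.Finite.subset (Set.finite_Iic _) fun m hm => hbdd.choose_spec hm
  obtain ⟨m, hm, hmax⟩ := Set.exists_max_image _ id hfin hne
  exact ⟨m, Or.inr (Or.inr ⟨h0, h1, hm, fun n hn => hmax n hn⟩)⟩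

theorem isRelevantPrefixLength_relevantLength {ξ : Word} (hξ : ξ ∈ E 2) :
    IsRelevantPrefixLength ξ (relevantLength ξ) := by
  have h := exists_isRelevantPrefixLength hξ
  rw [relevantLength, dif_pos h]
  exact h.choose_spec

theorem IsRelevantPrefixLength.apply_eq_false {ξ : Word} {m : ℕ} (h : IsRelevantPrefixLength ξ m)
    (i : ℕ) : ξ (m + 2 * i) = false := by
  rcases h with ⟨h, rfl⟩ | ⟨h, -, rfl⟩ | ⟨-, -, ⟨j, k, -, rfl, -, -, hk⟩, hmax⟩
  · simpa using h i
  · simpa [add_comm] using h i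
  · by_contra h1
    obtain ⟨m, hm, hm'⟩ := exists_endsInEvenBlock (i := j + k + 1) (by omega) (by omega) hk
      (Bool.eq_true_of_not_eq_false h1)
    have := hmax hm'
    omega

theorem not_cofinal_bar (ξ : Word) : ¬ Cofinal ξ (bar ξ) := by
  intro h
  obtain ⟨N, hN⟩ := cofinal_iff.1 h
  have h1 := hN (relevantLength ξ + 2 * N + 1) (by omega)
  rw [bar, if_pos ⟨N, rfl⟩] at h1
  simp at h1

/-- The Schreier graph of `bar ξ` is the image of that of `ξ` under a symmetry, and an isomorphism
between Schreier graphs agrees with the identity or with this symmetry on an infinite orbit of one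
of the generators. -/
theorem exists_symmetry {ξ : Word} (hξ : ξ ∈ E 2) :
    ∃ φ, IsSymmetry φ ∧ φ ξ ∈ MulAction.orbit basilicaGroup (bar ξ) ∧
      ∃ x ∈ MulAction.orbit basilicaGroup ξ, ∀ C D : Set Word, Invariant C → Invariant D →
        ∀ ψ, IsLabelIso ψ C D → x ∈ C → x ∈ D ∨ φ x ∈ D := by
  have h0 := (isRelevantPrefixLength_relevantLength hξ).apply_eq_false
  have hbar : ∀ n ≥ relevantLength ξ,
      bar ξ n = if (n + relevantLength ξ) % 2 = 1 then !(ξ n) else ξ n := by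
    intro n hn
    have : (∃ i, n = relevantLength ξ + 2 * i + 1) ↔ (n + relevantLength ξ) % 2 = 1 :=
      ⟨fun ⟨i, hi⟩ => by omega, fun h => ⟨(n - relevantLength ξ - 1) / 2, by omega⟩⟩
    simp only [bar, this]
  set m := relevantLength ξ with hm
  have h0' : ∀ n ≥ m, (n + m) % 2 = 0 → ξ n = false := by
    intro n hn hp
    have := h0 ((n - m) / 2)
    rwa [show m + 2 * ((n - m) / 2) = n by omega] at this
  obtain ⟨t, ht, ht1⟩ := exists_ge_eq_true hξ m
  have htm : (t + m) % 2 = 1 := by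
    by_contra h
    simp [h0' t ht (by omega)] at ht1
  -- The word `x` is cofinal with `ξ` and vanishes at all indices of the parity of `m`, so `x` or
  -- its tail lies on an infinite `b`-orbit.
  set x : Word := fun n => if n < m then false else ξ n with hx
  have hxξ : x ∈ MulAction.orbit basilicaGroup ξ := by
    refine Cofinal.mem_orbit (cofinal_iff.2 ⟨m, fun n hn => ?_⟩)
    simp [hx, not_lt.2 hn]
  have hx0 : ∀ n, (n + m) % 2 = 0 → x n = false := by
    intro n hn
    by_cases hnm : n < m
    · simp [hx, hnm]
    · simpa [hx, hnm] using h0' n (by omega) hn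
  rcases Nat.even_or_odd' m with ⟨c, hc | hc⟩
  · refine ⟨lift reflect, isSymmetry_lift_reflect, ?_, x, hxξ, ?_⟩
    · refine Cofinal.mem_orbit (cofinal_iff.2 ⟨t + 1, fun n hn => ?_⟩)
      obtain ⟨q, rfl⟩ : ∃ q, t = 2 * q + 1 := ⟨t / 2, by omega⟩
      obtain ⟨n, rfl⟩ : ∃ l, n = l + 1 := ⟨n - 1, by omega⟩
      have hr := reflect_apply_of_gt (w := tail ξ) (q := q) ht1
        (fun i hi => h0' (2 * i + 1 + 1) (by omega) (by omega)) (n := n) (by omega)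
      change _ = reflect (tail ξ) n
      rw [hr, hbar _ (by omega)]
      simp only [Nat.even_iff, show (n + 1 + m) % 2 = 1 ↔ n % 2 = 0 by omega]
      rfl
    · intro C D hC hD ψ hψ hxC
      have hcons : cons false (tail x) = x := by
        conv_rhs => rw [← cons_tail x, hx0 0 (by omega)]
      have := (hψ.descend hC hD).mem_or_reflect_mem hC.tail hD.tail (x := tail x)
        (show cons false (tail x) ∈ C by rwa [hcons])
        (fun i => hx0 (2 * i + 1 + 1) (by omega))
      rw [← hcons]
      exact this
  · refine ⟨reflect, isSymmetry_reflect, ?_, x, hxξ, ?_⟩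
    · refine Cofinal.mem_orbit (cofinal_iff.2 ⟨t + 1, fun n hn => ?_⟩)
      obtain ⟨q, rfl⟩ : ∃ q, t = 2 * q := ⟨t / 2, by omega⟩
      rw [reflect_apply_of_gt ht1 (fun i hi => h0' _ (by omega) (by omega)) (by omega),
        hbar _ (by omega)]
      simp only [Nat.even_iff, show (n + m) % 2 = 1 ↔ n % 2 = 0 by omega]
    · intro C D hC hD ψ hψ hxC
      exact hψ.mem_or_reflect_mem hC hD hxC fun i => hx0 _ (by omega)

theorem Γ_eq_of_mem_orbit {ξ η : Word} (h : η ∈ MulAction.orbit basilicaGroup ξ) : Γ η = Γ ξ := by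
  simp only [Γ, schreierGraph, orbit_eq_of_mem h]

theorem nonempty_iso_bar {ξ : Word} (hξ : ξ ∈ E 2) :
    Nonempty (MultigraphIso (Γ ξ) (Γ (bar ξ))) := by
  obtain ⟨φ, hφ, hmem, -⟩ := exists_symmetry hξ
  rw [← Γ_eq_of_mem_orbit hmem]
  exact hφ.nonempty_iso ξ

theorem mem_E_of_iso {ξ η : Word} {i : ℕ} (hξ : ξ ∈ E i) (f : MultigraphIso (Γ ξ) (Γ η)) :
    η ∈ E i := f.numEnds_eq.symm.trans hξ

theorem mem_orbit_of_iso {ξ η : Word} (hξ : ξ ∈ E 2) (f : MultigraphIso (Γ ξ) (Γ η)) :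
    η ∈ MulAction.orbit basilicaGroup ξ ∨ η ∈ MulAction.orbit basilicaGroup (bar ξ) := by
  obtain ⟨φ, hφ, hmem, x, hx, h⟩ := exists_symmetry hξ
  obtain ⟨ψ, hψ⟩ := f.exists_isLabelIso
  rcases h _ _ (orbit_invariant ξ) (orbit_invariant η) ψ hψ hx with h | h
  · left
    rw [← orbit_eq_of_mem hx, orbit_eq_of_mem h]
    exact MulAction.mem_orbit_self η
  · right
    rw [← orbit_eq_of_mem hmem, ← orbit_eq_of_mem (hφ.map_mem_orbit hx), orbit_eq_of_mem h]
    exact MulAction.mem_orbit_self η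

theorem iso_iff_mem_orbit {ξ : Word} (hξ : ξ ∈ E 2) (η : Word) :
    Nonempty (MultigraphIso (Γ ξ) (Γ η)) ↔
      η ∈ MulAction.orbit basilicaGroup ξ ∨ η ∈ MulAction.orbit basilicaGroup (bar ξ) := by
  refine ⟨fun ⟨f⟩ => mem_orbit_of_iso hξ f, ?_⟩
  rintro (h | h)
  · rw [Γ_eq_of_mem_orbit h]
    exact ⟨⟨Equiv.refl _, Equiv.refl _, fun _ _ _ => Iff.rfl⟩⟩
  · rw [Γ_eq_of_mem_orbit h]
    exact nonempty_iso_bar hξ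

theorem mem_orbit_iff_cofinal {ξ : Word} (hξ : ξ ∈ E 2) (η : Word) :
    η ∈ MulAction.orbit basilicaGroup ξ ↔ Cofinal ξ η :=
  ⟨cofinal_of_mem_orbit (zeroWord_notMem_orbit hξ), Cofinal.mem_orbit⟩

end Basilica

open Basilica in
theorem mainTheorem3 :
    -- For `ξ ∈ E 2`, the prefix `w` exists, `ξ = w 0 x₁ 0 x₂ …`, and `bar ξ ∈ E 2`.
    (∀ ξ ∈ E 2, IsRelevantPrefixLength ξ (relevantLength ξ) ∧
      (∀ i : ℕ, ξ (relevantLength ξ + 2 * i) = false) ∧ bar ξ ∈ E 2) ∧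
    -- The isomorphism criterion.
    (∀ ξ ∈ E 2, ∀ η ∈ E 2,
      Nonempty (MultigraphIso (Γ ξ) (Γ η)) ↔ (Cofinal ξ η ∨ Cofinal (bar ξ) η)) ∧
    -- The isomorphism class of each two-ended graph consists of exactly two orbits.
    (∀ ξ ∈ E 2,
      {O : Set Word | ∃ η : Word, O = MulAction.orbit basilicaGroup η ∧
        Nonempty (MultigraphIso (Γ ξ) (Γ η))}.ncard = 2) := by
  refine ⟨fun ξ hξ => ?_, fun ξ hξ η _ => ?_, fun ξ hξ => ?_⟩
  · have h := isRelevantPrefixLength_relevantLength hξ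
    obtain ⟨f⟩ := nonempty_iso_bar hξ
    exact ⟨h, h.apply_eq_false, mem_E_of_iso hξ f⟩
  · obtain ⟨f⟩ := nonempty_iso_bar hξ
    rw [iso_iff_mem_orbit hξ, mem_orbit_iff_cofinal hξ,
      mem_orbit_iff_cofinal (mem_E_of_iso hξ f)]
  · have hset : {O : Set Word | ∃ η : Word, O = MulAction.orbit basilicaGroup η ∧
        Nonempty (MultigraphIso (Γ ξ) (Γ η))} =
        {MulAction.orbit basilicaGroup ξ, MulAction.orbit basilicaGroup (bar ξ)} := by
      ext O
      constructor
      · rintro ⟨η, rfl, h⟩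
        exact ((iso_iff_mem_orbit hξ η).1 h).imp orbit_eq_of_mem orbit_eq_of_mem
      · rintro (rfl | rfl)
        · exact ⟨ξ, rfl, (iso_iff_mem_orbit hξ ξ).2 (Or.inl (MulAction.mem_orbit_self ξ))⟩
        · exact ⟨bar ξ, rfl, nonempty_iso_bar hξ⟩
    rw [hset]
    refine Set.ncard_pair fun h => not_cofinal_bar ξ ?_
    rw [← mem_orbit_iff_cofinal hξ, h]
    exact MulAction.mem_orbit_self _
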